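/- **Networks.** Let $L$, widths $n_0^\sigma,\dots,n_L^\sigma$, $n_1^r,\dots,n_L^r$ and degrees $d_1,\dots,d_{L+1}$ be natural numbers, and put $n_{L+1}^r=1$, $m_i=n_i^\sigma$ for $0\le i\le L-1$ and $m_L=n_L^\sigma+n_0^\sigma$. Let $\sigma_i:\mathbb R^{n_i^r}\to\mathbb R^{n_i^\sigma}$ ($1\le i\le L$) be continuous. For $a\in\mathbb R^{\binom{n+d}{d}}$ and $x\in\mathbb R^n$ write $q(a,x)=\sum_{k_1+\dots+k_n\le d}a_{k}\prod_l x_l^{k_l}$. For $\epsilon>0$ let $\bar Q^\epsilon(d,n)=\{b\in\mathbb R^{\binom{n+d}{d}}: q(b,x)\ge\epsilon\ \forall x\in\mathbb R^n,\ \|b\|_2=1\}$ and $$\Theta=\prod_{i=1}^{L+1}\Big(\big(\mathbb R^{\binom{m_{i-1}+d_i}{d_i}}\big)^{n_i^r}\times\bar Q^\epsilon(d_i,m_{i-1})^{n_i^r}\Big).$$ For $\theta\in\Theta$ with blocks $(a^i_j,b^i_j)_{1\le j\le n_i^r}$ let $r_i^\theta(x)=\big(q(a^i_j,x)/q(b^i_j,x)\big)_{j}$,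 and let $\mathfrak S_\sigma^\theta:\mathbb R^{n_0^\sigma}\to\mathbb R$, $$\mathfrak S^\theta_\sigma(x)=r^\theta_{L+1}\big((\sigma_L\circ r^\theta_L\circ\dots\circ\sigma_1\circ r^\theta_1)(x),x\big).$$ **Space setup.** Let $T>0$, let $\Omega\subset\mathbb R^d$ be bounded and open (for instance a bounded Lipschitz domain), $\kappa\in\mathbb N_0$, $1\le\hat q\le\hat p<\infty$ and $1\le q\le p<\infty$. Let $V,\tilde V,W$ and $V_k$ ($1\le k\le\kappa$) be reflexive, separable Banach spaces with continuous embeddings $V\hookrightarrow\tilde V\hookrightarrow W$, $L^{\hat q}(\Omega)\hookrightarrow W$, $L^{\hat p}(\Omega)\hookrightarrow V_k\hookrightarrow L^{\hat q}(\Omega)$, with a compact embedding $V\hookrightarrow W^{\kappa,\hat p}(\Omega)$, and with either $W^{\kappa,\hat p}(\Omega)\hookrightarrow\tilde V$ or $\tilde V\hookrightarrow W^{\kappa,\hat p}(\Omega)$; all embeddings are inclusions of function spaces and hence compatible with each other. Put $$\mathcal V=L^p(0,T;V)\cap W^{1,p,p}(0,T;\tilde V)=\{v\in L^p(0,T;V):\partial_tv\in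 L^p(0,T;\tilde V)\},\qquad \mathcal W=L^q(0,T;W),$$ $\mathcal V_0^\times=\mathcal V$ and $\mathcal V_k^\times=L^p(0,T;V_k^{p_k})$ with $p_k=\binom{d+k-1}{k}$ for $1\le k\le\kappa$, and $\mathcal J_\kappa v=\big(v,(D^\beta v)_{|\beta|=1},\dots,(D^\beta v)_{|\beta|=\kappa}\big)\in\prod_{k=0}^\kappa\mathcal V_k^\times$ for $v\in\mathcal V$. Suppose that there is a constant $c>0$ with $\|\mathcal J_\kappa v\|_{L^\infty((0,T)\times\Omega)}\le c\|v\|_{\mathcal V}$ for all $v\in\mathcal V$. **Proposition.** Suppose first that the inputs of the network are either the values $u(t,x)$ of $u\in\prod_{k=0}^\kappa\mathcal V_k^\times$ (so $n_0^\sigma=\sum_{k=0}^\kappa p_k$ with $p_0=1$) or the values $(t,u(t,x))$ (so $n_0^\sigma=1+\sum_{k=0}^\kappa p_k$). In the second case read $\mathfrak S_\sigma^\theta(t,u(t,\cdot))$ for $\mathfrak S_\sigma^\theta(u(t,\cdot))$ below. 1. For every $\theta\in\Theta$ the network induces well-defined Nemytskii operators $$\mathfrak S^\theta_\sigma:\Big\{u\in\prod_{k=0}^\kappa\mathcal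 V_k^\times: u\in L^\infty((0,T)\times\Omega)\Big\}\to L^q(0,T;L^{\hat q}(\Omega))\quad\text{and}\quad\to\mathcal W,$$ both via $[\mathfrak S_\sigma^\theta(u)](t)=\mathfrak S_\sigma^\theta(u(t,\cdot))$. Their common domain contains $\mathcal J_\kappa v$ for every $v\in\mathcal V$. 2. If $\sigma_1,\dots,\sigma_L$ are locally Lipschitz continuous, then the map $\Theta\times\mathcal V\to\mathcal W$, $(\theta,v)\mapsto\mathfrak S_\sigma^\theta(\mathcal J_\kappa v)$, is weak-strong continuous: if $\theta^m\to\theta$ in $\Theta$ and $v^m\rightharpoonup v$ weakly in $\mathcal V$, then $\mathfrak S_\sigma^{\theta^m}(\mathcal J_\kappa v^m)\to\mathfrak S_\sigma^\theta(\mathcal J_\kappa v)$ in $\mathcal W$. Moreover, for every $n_0^\sigma$ and every bounded $U\subset\mathbb R^{n_0^\sigma}$: 3. The map $\Theta\ni\theta\mapsto\mathfrak S_\sigma^\theta\in L^\infty(U)$ is well defined and continuous. -/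

import Mathlib

open MeasureTheory Filter Topology
open scoped ENNReal ContDiff

noncomputable section

/-! ### Rational functions and symbolic networks -/

/-- Exponents `(k₁, …, kₙ)` with `k₁ + … + kₙ ≤ d`; there are `(n + d).choose d` of them. -/
abbrev MonIdx (n d : ℕ) : Type :=
  {k : Fin n → Fin (d + 1) // ∑ l, (k l : ℕ) ≤ d}

/-- Coefficient vectors of polynomials of degree at most `d` in `n` variables,
with the Euclidean norm. -/
abbrev Coeff (n d : ℕ) : Type := EuclideanSpace ℝ (MonIdx n d)

/-- The polynomial `q(a, x) = ∑ₖ aₖ x₁^k₁ ⋯ xₙ^kₙ`. -/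
def polyEval {n d : ℕ} (a : Coeff n d) (x : Fin n → ℝ) : ℝ :=
  ∑ k : MonIdx n d, a k * ∏ l, x l ^ (k.1 l : ℕ)

/-- Normalised coefficients of polynomials that are bounded below by `ε`. -/
def normDenom (ε : ℝ) (n d : ℕ) : Set (Coeff n d) :=
  {b | (∀ x : Fin n → ℝ, ε ≤ polyEval b x) ∧ ‖b‖ = 1}

/-- Numerator and denominator coefficients of the `m` components of a rational map
`ℝⁿ → ℝᵐ` of degree at most `d`. -/
abbrev LayerParam (n m d : ℕ) : Type := (Fin m → Coeff n d) × (Fin m → Coeff n d)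

/-- The rational map with the given coefficients. -/
def ratMap {n m d : ℕ} (c : LayerParam n m d) (x : Fin n → ℝ) : Fin m → ℝ :=
  fun j => polyEval (c.1 j) x / polyEval (c.2 j) x

/-- Architecture of a symbolic network: depth `L`, widths `nσ i` (`0 ≤ i ≤ L`) and `nr i`
(`1 ≤ i ≤ L`), degrees `deg i` (`1 ≤ i ≤ L + 1`) and activations `σ i` (`1 ≤ i ≤ L`).
Entries with other indices are never used. -/
structure SymArch where
  L : ℕ
  nσ : ℕ → ℕ
  nr : ℕ → ℕ
  deg : ℕ → ℕ
  σ : ∀ i : ℕ, (Fin (nr i) → ℝ) → (Fin (nσ i) → ℝ)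

namespace SymArch

/-- All coefficients of the rational maps `r₁, …, r_L` (first factor, where `i : Fin L` stands
for the layer `i + 1`) and `r_{L+1}` (second factor). -/
abbrev Param (A : SymArch) : Type :=
  (∀ i : Fin A.L, LayerParam (A.nσ i) (A.nr (i + 1)) (A.deg (i + 1))) ×
    LayerParam (A.nσ A.L + A.nσ 0) 1 (A.deg (A.L + 1))

/-- The parameter set `Θ`: arbitrary numerators, normalised denominators bounded below
by `ε`. -/
def paramSet (A : SymArch) (ε : ℝ) : Set A.Param :=
  {θ | (∀ (i : Fin A.L) (j : Fin (A.nr (i + 1))),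
          (θ.1 i).2 j ∈ normDenom ε (A.nσ i) (A.deg (i + 1))) ∧
        ∀ j : Fin 1, θ.2.2 j ∈ normDenom ε (A.nσ A.L + A.nσ 0) (A.deg (A.L + 1))}

/-- The hidden layers `σ_k ∘ r_k ∘ ⋯ ∘ σ₁ ∘ r₁`. -/
def hidden (A : SymArch) (θ : A.Param) :
    (k : ℕ) → k ≤ A.L → (Fin (A.nσ 0) → ℝ) → (Fin (A.nσ k) → ℝ)
  | 0, _, x => x
  | k + 1, hk, x =>
      A.σ (k + 1) (ratMap (θ.1 ⟨k, hk⟩) (A.hidden θ k (Nat.le_of_succ_le hk) x))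

/-- The network `x ↦ r_{L+1}((σ_L ∘ r_L ∘ ⋯ ∘ σ₁ ∘ r₁)(x), x)`. -/
def net (A : SymArch) (θ : A.Param) (x : Fin (A.nσ 0) → ℝ) : ℝ :=
  ratMap θ.2 (Fin.append (A.hidden θ A.L le_rfl x) x) 0

end SymArch

/-! ### Weak derivatives and Sobolev spaces -/

/-- Multi-indices `β ∈ ℕ₀ᵈ` of order exactly `k`. -/
abbrev MultiIdx (d k : ℕ) : Type :=
  {β : Fin d → Fin (k + 1) // ∑ i, (β i : ℕ) = k}

/-- Indices of the components `D^β v`, `|β| ≤ κ`: the order zero component, and one for each `β`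
of order `k + 1`, `k : Fin κ`. -/
abbrev JetIdx (d κ : ℕ) : Type := Unit ⊕ (Σ k : Fin κ, MultiIdx d (k + 1))

/-- The classical partial derivative `∂ᵢ`. -/
def pderivAt {d : ℕ} (i : Fin d) (φ : EuclideanSpace ℝ (Fin d) → ℝ) :
    EuclideanSpace ℝ (Fin d) → ℝ :=
  fun x => fderiv ℝ φ x (EuclideanSpace.single i 1)

/-- The classical derivative `D^β = ∂₁^β₁ ⋯ ∂_d^β_d`. -/
def multiDeriv {d : ℕ} (β : Fin d → ℕ) (φ : EuclideanSpace ℝ (Fin d) → ℝ) :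
    EuclideanSpace ℝ (Fin d) → ℝ :=
  (List.finRange d).foldr (fun i ψ => (pderivAt i)^[β i] ψ) φ

/-- `φ ∈ C_c^∞(U)`. -/
def IsTest {E : Type*} [NormedAddCommGroup E] [NormedSpace ℝ E] (U : Set E) (φ : E → ℝ) : Prop :=
  ContDiff ℝ ∞ φ ∧ HasCompactSupport φ ∧ tsupport φ ⊆ U

/-- `g` is the weak derivative `D^β f` on `Ω`. -/
def IsWeakDeriv {d k : ℕ} (Ω : Set (EuclideanSpace ℝ (Fin d))) (β : MultiIdx d k)
    (f g : EuclideanSpace ℝ (Fin d) → ℝ) : Prop :=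
  ∀ φ : EuclideanSpace ℝ (Fin d) → ℝ, IsTest Ω φ →
    ∫ x in Ω, f x * multiDeriv (fun i => (β.1 i : ℕ)) φ x = (-1) ^ k * ∫ x in Ω, g x * φ x

section helpers

variable {d : ℕ}

lemma pderivAt_smooth (i : Fin d) {φ : EuclideanSpace ℝ (Fin d) → ℝ}
    (h : ContDiff ℝ ∞ φ ∧ HasCompactSupport φ) :
    ContDiff ℝ ∞ (pderivAt i φ) ∧ HasCompactSupport (pderivAt i φ) :=
  ⟨(h.1.fderiv_right (m := ∞) (by simp)).clm_apply contDiff_const,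
    h.2.fderiv_apply (𝕜 := ℝ) _⟩

lemma multiDeriv_smooth (β : Fin d → ℕ) {φ : EuclideanSpace ℝ (Fin d) → ℝ}
    (h : ContDiff ℝ ∞ φ ∧ HasCompactSupport φ) :
    ContDiff ℝ ∞ (multiDeriv β φ) ∧ HasCompactSupport (multiDeriv β φ) := by
  unfold multiDeriv
  induction List.finRange d with
  | nil => simpa using h
  | cons i l ih =>
    simp only [List.foldr_cons]
    generalize l.foldr (fun i ψ => (pderivAt i)^[β i] ψ) φ = ψ at ih
    induction β i with
    | zero => simpa using ih
    | succ n ihn =>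
      rw [Function.iterate_succ_apply']
      exact pderivAt_smooth i ihn

lemma integrable_mul_of_test {p : ℝ≥0∞} [hp : Fact (1 ≤ p)] {μ : Measure (EuclideanSpace ℝ (Fin d))}
    [IsFiniteMeasureOnCompacts μ] (f : Lp ℝ p μ) {ψ : EuclideanSpace ℝ (Fin d) → ℝ}
    (h : ContDiff ℝ ∞ ψ ∧ HasCompactSupport ψ) : Integrable (fun x => f x * ψ x) μ := by
  have := ENNReal.HolderConjugate.conjExponent hp.out
  exact (Lp.memLp f).integrable_mul (q := p.conjExponent)
    (h.1.continuous.memLp_of_hasCompactSupport h.2)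

lemma IsWeakDeriv.zero {k : ℕ} {Ω : Set (EuclideanSpace ℝ (Fin d))} {p : ℝ≥0∞}
    (β : MultiIdx d k) :
    IsWeakDeriv Ω β ((0 : Lp ℝ p (volume.restrict Ω)) : EuclideanSpace ℝ (Fin d) → ℝ)
      ((0 : Lp ℝ p (volume.restrict Ω)) : EuclideanSpace ℝ (Fin d) → ℝ) := by
  intro φ _
  have h0 : ∀ ψ : EuclideanSpace ℝ (Fin d) → ℝ,
      ∫ x in Ω, (0 : Lp ℝ p (volume.restrict Ω)) x * ψ x = 0 := by
    intro ψ
    apply integral_eq_zero_of_ae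
    filter_upwards [Lp.coeFn_zero ℝ p (volume.restrict Ω)] with x hx
    rw [hx, Pi.zero_apply, zero_mul]
  rw [h0, h0, mul_zero]

lemma IsWeakDeriv.add {k : ℕ} {Ω : Set (EuclideanSpace ℝ (Fin d))} {p : ℝ≥0∞} [Fact (1 ≤ p)]
    {β : MultiIdx d k} {f f' g g' : Lp ℝ p (volume.restrict Ω)} (h : IsWeakDeriv Ω β f g)
    (h' : IsWeakDeriv Ω β f' g') :
    IsWeakDeriv Ω β ((f + f' : Lp ℝ p (volume.restrict Ω)) : EuclideanSpace ℝ (Fin d) → ℝ)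
      ((g + g' : Lp ℝ p (volume.restrict Ω)) : EuclideanSpace ℝ (Fin d) → ℝ) := by
  intro φ hφ
  have key : ∀ (a b : Lp ℝ p (volume.restrict Ω)) (ψ : EuclideanSpace ℝ (Fin d) → ℝ),
      ContDiff ℝ ∞ ψ ∧ HasCompactSupport ψ →
      ∫ x in Ω, (a + b : Lp ℝ p (volume.restrict Ω)) x * ψ x
        = (∫ x in Ω, a x * ψ x) + ∫ x in Ω, b x * ψ x := by
    intro a b ψ hψ
    rw [← integral_add (integrable_mul_of_test a hψ) (integrable_mul_of_test b hψ)]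
    apply integral_congr_ae
    filter_upwards [Lp.coeFn_add a b] with x hx
    rw [hx, Pi.add_apply, add_mul]
  have hs := And.intro hφ.1 hφ.2.1
  rw [key _ _ _ (multiDeriv_smooth _ hs), key _ _ _ hs, h φ hφ, h' φ hφ, mul_add]

lemma IsWeakDeriv.smul {k : ℕ} {Ω : Set (EuclideanSpace ℝ (Fin d))} {p : ℝ≥0∞}
    {β : MultiIdx d k} (c : ℝ) {f g : Lp ℝ p (volume.restrict Ω)} (h : IsWeakDeriv Ω β f g) :
    IsWeakDeriv Ω β ((c • f : Lp ℝ p (volume.restrict Ω)) : EuclideanSpace ℝ (Fin d) → ℝ)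
      ((c • g : Lp ℝ p (volume.restrict Ω)) : EuclideanSpace ℝ (Fin d) → ℝ) := by
  intro φ hφ
  have key : ∀ (a : Lp ℝ p (volume.restrict Ω)) (ψ : EuclideanSpace ℝ (Fin d) → ℝ),
      ∫ x in Ω, (c • a : Lp ℝ p (volume.restrict Ω)) x * ψ x = c * ∫ x in Ω, a x * ψ x := by
    intro a ψ
    rw [← integral_const_mul]
    apply integral_congr_ae
    filter_upwards [Lp.coeFn_smul c a] with x hx
    rw [hx, Pi.smul_apply, smul_eq_mul, mul_assoc]
  rw [key, key, h φ hφ]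
  ring

end helpers

/-- The Sobolev space `W^{κ,p}(Ω)`: functions `f ∈ L^p(Ω)` together with their weak derivatives
`((D^β f)_{|β|=1}, …, (D^β f)_{|β|=κ})`, all in `L^p(Ω)` (`k : Fin κ` stands for the order
`k + 1`). The norm is the maximum of the `L^p` norms of the derivatives of order at most `κ`. -/
def SobolevSpace {d : ℕ} (κ : ℕ) (p : ℝ≥0∞) [Fact (1 ≤ p)] (Ω : Set (EuclideanSpace ℝ (Fin d))) :
    Submodule ℝ (Lp ℝ p (volume.restrict Ω) ×
      (∀ k : Fin κ, MultiIdx d (k + 1) → Lp ℝ p (volume.restrict Ω))) where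
  carrier := {f | ∀ (k : Fin κ) (β : MultiIdx d (k + 1)), IsWeakDeriv Ω β f.1 (f.2 k β)}
  zero_mem' := fun _ β => IsWeakDeriv.zero β
  add_mem' := fun hf hg k β => (hf k β).add (hg k β)
  smul_mem' := fun c _ hf k β => (hf k β).smul c

/-- The inclusion `W^{κ,p}(Ω) → L^p(Ω)`. -/
def SobolevSpace.val {d κ : ℕ} {p : ℝ≥0∞} [Fact (1 ≤ p)] {Ω : Set (EuclideanSpace ℝ (Fin d))} :
    SobolevSpace κ p Ω →L[ℝ] Lp ℝ p (volume.restrict Ω) :=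
  (ContinuousLinearMap.fst ℝ _ _) ∘L (SobolevSpace κ p Ω).subtypeL

/-- The weak derivative `D^β : W^{κ,p}(Ω) → L^p(Ω)`, `|β| = k + 1`. -/
def SobolevSpace.deriv {d κ : ℕ} {p : ℝ≥0∞} [Fact (1 ≤ p)] {Ω : Set (EuclideanSpace ℝ (Fin d))}
    (k : Fin κ) (β : MultiIdx d (k + 1)) :
    SobolevSpace κ p Ω →L[ℝ] Lp ℝ p (volume.restrict Ω) :=
  (ContinuousLinearMap.proj β) ∘L (ContinuousLinearMap.proj k) ∘L
    (ContinuousLinearMap.snd ℝ _ _) ∘L (SobolevSpace κ p Ω).subtypeL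

/-! ### The dynamic state space -/

/-- Lebesgue measure on the time interval `(0, T)`. -/
abbrev timeMeasure (T : ℝ) : Measure ℝ := volume.restrict (Set.Ioo 0 T)

/-- `g` is the distributional time derivative of `u` on `(0, T)`. -/
def IsTimeDeriv {E : Type*} [NormedAddCommGroup E] [NormedSpace ℝ E] (T : ℝ) (u g : ℝ → E) :
    Prop :=
  ∀ φ : ℝ → ℝ, IsTest (Set.Ioo 0 T) φ →
    ∫ t in Set.Ioo 0 T, deriv φ t • u t = - ∫ t in Set.Ioo 0 T, φ t • g t

lemma integrable_smul_of_test {E : Type*} [NormedAddCommGroup E] [NormedSpace ℝ E] {T : ℝ}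
    {p : ℝ≥0∞} [hp : Fact (1 ≤ p)] (f : Lp E p (timeMeasure T)) {ψ : ℝ → ℝ}
    (hc : Continuous ψ) (hs : HasCompactSupport ψ) :
    Integrable (fun t => ψ t • f t) (timeMeasure T) := by
  have := ENNReal.HolderConjugate.conjExponent hp.out
  exact memLp_one_iff_integrable.1 ((Lp.memLp f).smul (p := p.conjExponent) (q := p) (r := 1)
    (hc.memLp_of_hasCompactSupport hs))

/-- The Sobolev–Bochner space `L^p(0,T;V) ∩ W^{1,p,p}(0,T;Ṽ)`, where `ι : V → Ṽ` is the embedding: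
functions `u ∈ L^p(0,T;V)` together with their time derivative `∂ₜu ∈ L^p(0,T;Ṽ)`. The norm is the
maximum of the norms of `u` in `L^p(0,T;V)` and of `∂ₜu` in `L^p(0,T;Ṽ)`. -/
def StateSpace {V V' : Type*} [NormedAddCommGroup V] [NormedSpace ℝ V]
    [NormedAddCommGroup V'] [NormedSpace ℝ V'] (T : ℝ) (p : ℝ≥0∞) [Fact (1 ≤ p)]
    (ι : V →L[ℝ] V') : Submodule ℝ (Lp V p (timeMeasure T) × Lp V' p (timeMeasure T)) where
  carrier := {u | IsTimeDeriv T (fun t => (ι.compLp u.1) t) u.2}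
  zero_mem' := by
    intro φ _
    have h0 : ∀ ψ : ℝ → ℝ,
        ∫ t in Set.Ioo 0 T, ψ t • (0 : Lp V' p (timeMeasure T)) t = 0 := by
      intro ψ
      apply integral_eq_zero_of_ae
      filter_upwards [Lp.coeFn_zero V' p (timeMeasure T)] with x hx
      rw [hx, Pi.zero_apply, smul_zero]
    have h1 : ι.compLp (0 : Lp V p (timeMeasure T)) = 0 := (ι.compLpL p (timeMeasure T)).map_zero
    simp only [Prod.fst_zero, Prod.snd_zero, h1, h0, neg_zero]
  add_mem' := by
    intro u v hu hv φ hφ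
    have key : ∀ (a b : Lp V' p (timeMeasure T)) (ψ : ℝ → ℝ),
        Continuous ψ → HasCompactSupport ψ →
        ∫ t in Set.Ioo 0 T, ψ t • (a + b : Lp V' p (timeMeasure T)) t
          = (∫ t in Set.Ioo 0 T, ψ t • a t) + ∫ t in Set.Ioo 0 T, ψ t • b t := by
      intro a b ψ hc hs
      rw [← integral_add (integrable_smul_of_test a hc hs) (integrable_smul_of_test b hc hs)]
      apply integral_congr_ae
      filter_upwards [Lp.coeFn_add a b] with x hx
      rw [hx, Pi.add_apply, smul_add]
    have h1 : ι.compLp (u.1 + v.1) = ι.compLp u.1 + ι.compLp v.1 :=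
      (ι.compLpL p (timeMeasure T)).map_add u.1 v.1
    have hd : Continuous (deriv φ) := hφ.1.continuous_deriv (by simp)
    have e1 := hu φ hφ
    have e2 := hv φ hφ
    simp only [Prod.fst_add, Prod.snd_add, h1]
    rw [key _ _ _ hd hφ.2.1.deriv, key _ _ _ hφ.1.continuous hφ.2.1, e1, e2, neg_add]
  smul_mem' := by
    intro c u hu φ hφ
    have key : ∀ (a : Lp V' p (timeMeasure T)) (ψ : ℝ → ℝ),
        ∫ t in Set.Ioo 0 T, ψ t • (c • a : Lp V' p (timeMeasure T)) t
          = c • ∫ t in Set.Ioo 0 T, ψ t • a t := by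
      intro a ψ
      rw [← integral_smul]
      apply integral_congr_ae
      filter_upwards [Lp.coeFn_smul c a] with x hx
      rw [hx, Pi.smul_apply, smul_comm]
    have h1 : ι.compLp (c • u.1) = c • ι.compLp u.1 :=
      (ι.compLpL p (timeMeasure T)).map_smul c u.1
    have e1 := hu φ hφ
    simp only [Prod.smul_fst, Prod.smul_snd, h1]
    rw [key, key, e1, smul_neg]

/-! ### The space setup -/

/-- Reflexivity: the canonical embedding into the bidual is onto. -/
def IsReflexive (E : Type*) [NormedAddCommGroup E] [NormedSpace ℝ E] : Prop :=
  Function.Surjective (NormedSpace.inclusionInDoubleDual ℝ E)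

/-- The embedding maps of the space setup for the Banach spaces `V` (states), `V' = Ṽ`,
`W` (images) and `Vk k` (derivatives of order `k + 1`, `k : Fin κ`). -/
structure SpaceMaps {d : ℕ} (κ : ℕ) (Ω : Set (EuclideanSpace ℝ (Fin d)))
    (p' q' : ℝ≥0∞) [Fact (1 ≤ p')] [Fact (1 ≤ q')] (V V' W : Type*) (Vk : Fin κ → Type*)
    [NormedAddCommGroup V] [NormedSpace ℝ V] [NormedAddCommGroup V'] [NormedSpace ℝ V']
    [NormedAddCommGroup W] [NormedSpace ℝ W]
    [∀ k, NormedAddCommGroup (Vk k)] [∀ k, NormedSpace ℝ (Vk k)] where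
  /-- `V ↪ Ṽ` -/
  toV' : V →L[ℝ] V'
  /-- `Ṽ ↪ W` -/
  v'ToW : V' →L[ℝ] W
  /-- `V ↪ W^{κ,p̂}(Ω)` -/
  toSob : V →L[ℝ] SobolevSpace κ p' Ω
  /-- `L^q̂(Ω) ↪ W` -/
  lqToW : Lp ℝ q' (volume.restrict Ω) →L[ℝ] W
  /-- `L^p̂(Ω) ↪ V_k` -/
  lpToVk : ∀ k, Lp ℝ p' (volume.restrict Ω) →L[ℝ] Vk k
  /-- `V_k ↪ L^q̂(Ω)` -/
  vkToLq : ∀ k, Vk k →L[ℝ] Lp ℝ q' (volume.restrict Ω)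

namespace SpaceMaps

variable {d κ : ℕ} {Ω : Set (EuclideanSpace ℝ (Fin d))} {p' q' : ℝ≥0∞}
  [Fact (1 ≤ p')] [Fact (1 ≤ q')] {V V' W : Type*} {Vk : Fin κ → Type*}
  [NormedAddCommGroup V] [NormedSpace ℝ V] [NormedAddCommGroup V'] [NormedSpace ℝ V']
  [NormedAddCommGroup W] [NormedSpace ℝ W]
  [∀ k, NormedAddCommGroup (Vk k)] [∀ k, NormedSpace ℝ (Vk k)]

/-- The dynamic state space `𝒱 = L^p(0,T;V) ∩ W^{1,p,p}(0,T;Ṽ)`. -/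
abbrev State (S : SpaceMaps κ Ω p' q' V V' W Vk) (T : ℝ) (p : ℝ≥0∞) [Fact (1 ≤ p)] : Type _ :=
  StateSpace T p S.toV'

/-- The element `f` of `W^{κ,p̂}(Ω)` and the element `w` of `W` are the same function: as
`W^{κ,p̂}(Ω) ⊆ L^p̂(Ω) ⊆ L^q̂(Ω)`, `f` is a function in `L^q̂(Ω) ↪ W`. -/
def SameInW (S : SpaceMaps κ Ω p' q' V V' W Vk) (f : SobolevSpace κ p' Ω) (w : W) : Prop :=
  ∃ g : Lp ℝ q' (volume.restrict Ω),
    g =ᵐ[volume.restrict Ω] SobolevSpace.val f ∧ S.lqToW g = w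

/-- All maps are inclusions of function spaces, that is, injections that are compatible with each
other. As every space embeds into `W`, compatibility is expressed in `W` (and in `L^q̂(Ω)` for the
spaces `Vk k`). -/
structure Embeddings (S : SpaceMaps κ Ω p' q' V V' W Vk) : Prop where
  toV'_inj : Function.Injective S.toV'
  v'ToW_inj : Function.Injective S.v'ToW
  toSob_inj : Function.Injective S.toSob
  /-- The embedding `V ↪ W^{κ,p̂}(Ω)` is compact. -/
  toSob_compact : IsCompactOperator S.toSob
  lqToW_inj : Function.Injective S.lqToW
  /-- `V ↪ Ṽ ↪ W` and `V ↪ W^{κ,p̂}(Ω) ⊆ L^q̂(Ω) ↪ W` agree. -/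
  toW_compat : ∀ v : V, S.SameInW (S.toSob v) (S.v'ToW (S.toV' v))
  lpToVk_inj : ∀ k, Function.Injective (S.lpToVk k)
  vkToLq_inj : ∀ k, Function.Injective (S.vkToLq k)
  /-- `L^p̂(Ω) ↪ V_k ↪ L^q̂(Ω)` is the inclusion. -/
  vk_compat : ∀ k (f : Lp ℝ p' (volume.restrict Ω)),
    S.vkToLq k (S.lpToVk k f) =ᵐ[volume.restrict Ω] f

/-- Either `W^{κ,p̂}(Ω) ↪ Ṽ` or `Ṽ ↪ W^{κ,p̂}(Ω)`. -/
def SobolevComparable (S : SpaceMaps κ Ω p' q' V V' W Vk) : Prop :=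
  (∃ j : SobolevSpace κ p' Ω →L[ℝ] V', Function.Injective j ∧ ∀ f, S.SameInW f (S.v'ToW (j f))) ∨
  (∃ j : V' →L[ℝ] SobolevSpace κ p' Ω, Function.Injective j ∧ ∀ w, S.SameInW (j w) (S.v'ToW w))

/-- `‖𝒥_κ v‖_{L^∞((0,T)×Ω)} ≤ c ‖v‖_𝒱` for all `v ∈ 𝒱`, with a constant `c`. -/
def UniformBound (S : SpaceMaps κ Ω p' q' V V' W Vk) (T : ℝ) (p : ℝ≥0∞) [Fact (1 ≤ p)] : Prop :=
  ∃ c : ℝ, 0 < c ∧ ∀ v : S.State T p,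
    ∀ᵐ t ∂timeMeasure T, ∀ᵐ x ∂volume.restrict Ω,
      |SobolevSpace.val (S.toSob (v.1.1 t)) x| ≤ c * ‖v‖ ∧
      ∀ (k : Fin κ) (β : MultiIdx d (k + 1)),
        |SobolevSpace.deriv k β (S.toSob (v.1.1 t)) x| ≤ c * ‖v‖

/-- The space setup, for Banach spaces `V`, `Ṽ`, `W`, `Vk k`. -/
structure IsSetup (S : SpaceMaps κ Ω p' q' V V' W Vk) (T : ℝ) (p q : ℝ≥0∞) [Fact (1 ≤ p)] :
    Prop where
  isOpen : IsOpen Ω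
  isBounded : Bornology.IsBounded Ω
  time_pos : 0 < T
  p_ne_top : p ≠ ⊤
  q_le_p : q ≤ p
  p'_ne_top : p' ≠ ⊤
  q'_le_p' : q' ≤ p'
  separable : TopologicalSpace.SeparableSpace V ∧ TopologicalSpace.SeparableSpace V' ∧
    TopologicalSpace.SeparableSpace W ∧ ∀ k, TopologicalSpace.SeparableSpace (Vk k)
  reflexive : IsReflexive V ∧ IsReflexive V' ∧ IsReflexive W ∧ ∀ k, IsReflexive (Vk k)
  embeddings : S.Embeddings
  comparable : S.SobolevComparable
  uniform : S.UniformBound T p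

/-- The product `𝒱 × 𝒱_1^× × ⋯ × 𝒱_κ^×` with `𝒱_k^× = L^p(0,T;V_k^×)`. -/
abbrev Jets (S : SpaceMaps κ Ω p' q' V V' W Vk) (T : ℝ) (p : ℝ≥0∞) [Fact (1 ≤ p)] : Type _ :=
  S.State T p × (∀ k : Fin κ, Lp (MultiIdx d (k + 1) → Vk k) p (timeMeasure T))

/-- The static Jacobian mapping `J^{k+1} : V → V_{k+1}^×`, `v ↦ (D^β v)_{|β|=k+1}`. -/
def jacobian (S : SpaceMaps κ Ω p' q' V V' W Vk) (k : Fin κ) :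
    V →L[ℝ] (MultiIdx d (k + 1) → Vk k) :=
  ContinuousLinearMap.pi fun β => S.lpToVk k ∘L SobolevSpace.deriv k β ∘L S.toSob

variable {T : ℝ} {p : ℝ≥0∞} [Fact (1 ≤ p)]

/-- `𝒥_κ v = (v, J^1 v, …, J^κ v)`, applied at almost every time. -/
def jetMap (S : SpaceMaps κ Ω p' q' V V' W Vk) (v : S.State T p) : S.Jets T p :=
  (v, fun k => (S.jacobian k).compLp v.1.1)

/-- The values `u(t,x) = (u_β(t)(x))_{|β| ≤ κ}`. -/
def jetVal (S : SpaceMaps κ Ω p' q' V V' W Vk) (u : S.Jets T p) (t : ℝ)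
    (x : EuclideanSpace ℝ (Fin d)) : JetIdx d κ → ℝ
  | .inl _ => SobolevSpace.val (S.toSob (u.1.1.1 t)) x
  | .inr ⟨k, β⟩ => S.vkToLq k (u.2 k t β) x

/-- The vector `(t, u(t,x))` (if `τ = 1`) or `u(t,x)` (if `τ = 0`), its coordinates enumerated
by `e`. -/
def input (S : SpaceMaps κ Ω p' q' V V' W Vk) {τ n : ℕ} (e : Fin τ ⊕ JetIdx d κ ≃ Fin n)
    (u : S.Jets T p) (t : ℝ) (x : EuclideanSpace ℝ (Fin d)) : Fin n → ℝ :=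
  fun i => Sum.elim (fun _ => t) (S.jetVal u t x) (e.symm i)

/-- `u ∈ L^∞((0,T)×Ω)`, componentwise. -/
def EssBounded (S : SpaceMaps κ Ω p' q' V V' W Vk) (u : S.Jets T p) : Prop :=
  ∃ M : ℝ, ∀ᵐ t ∂timeMeasure T, ∀ᵐ x ∂volume.restrict Ω, ∀ i, |S.jetVal u t x i| ≤ M

/-- `F ∈ L^q(0,T;L^q̂(Ω))` is given by `F(t) = h(t, u(t,·))` or `F(t) = h(u(t,·))`. -/
def IsNemytskii (S : SpaceMaps κ Ω p' q' V V' W Vk) {τ n : ℕ} (e : Fin τ ⊕ JetIdx d κ ≃ Fin n)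
    (h : (Fin n → ℝ) → ℝ) (u : S.Jets T p) {q : ℝ≥0∞} [Fact (1 ≤ q)]
    (F : Lp (Lp ℝ q' (volume.restrict Ω)) q (timeMeasure T)) : Prop :=
  ∀ᵐ t ∂timeMeasure T, F t =ᵐ[volume.restrict Ω] fun x => h (S.input e u t x)

/-- `G ∈ 𝒲 = L^q(0,T;W)` is given by `G(t) = h(t, u(t,·))` or `G(t) = h(u(t,·))`, where this
function belongs to `L^q̂(Ω) ↪ W`. -/
def IsNemytskiiW (S : SpaceMaps κ Ω p' q' V V' W Vk) {τ n : ℕ}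
    (e : Fin τ ⊕ JetIdx d κ ≃ Fin n) (h : (Fin n → ℝ) → ℝ) (u : S.Jets T p) {q : ℝ≥0∞}
    [Fact (1 ≤ q)] (G : Lp W q (timeMeasure T)) : Prop :=
  ∀ᵐ t ∂timeMeasure T, ∃ f : Lp ℝ q' (volume.restrict Ω),
    f =ᵐ[volume.restrict Ω] (fun x => h (S.input e u t x)) ∧ G t = S.lqToW f

end SpaceMaps

end

noncomputable section

/-! ### Continuity of networks in parameters and inputs -/

/-! On `Θ` every denominator is at least `ε`, so the network is jointly continuous in parameter and
input. Uniform convergence on the compact set `closure U` then gives the `L^∞` statement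
(`exists_continuous_toLinfty`).

For the Nemytskii operators, the inputs are essentially bounded by some `M`, so the network may be
composed with truncation to `[-M, M]` without changing its values. The truncated superposition
operator is continuous on `L^q̂(Ω)`, jointly in the parameter, and bounded uniformly over compact
sets of parameters (`exists_superposition`). This yields measurability and integrability in time.

For weak-strong continuity, a weakly convergent sequence of states is norm bounded, so one `M`
serves all its members. The Aubin–Lions lemma (`IsSetup.tendsto_integral_norm_toSob`) makes it
converge in `L^1(0,T;W^{κ,p̂}(Ω))`, hence along a subsequence in `W^{κ,p̂}(Ω)` at almost every time.
Continuity of the superposition operator gives convergence in `L^q̂(Ω)` at those times, and bounded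
convergence gives it in `L^q(0,T;L^q̂(Ω))`. The embedding into `W` is then applied.

Aubin–Lions itself rests on two estimates. Ehrling's inequality reduces the claim to convergence in
`L^1(0,T;W)`. There, Poincaré's inequality on `N` short intervals bounds the norm by finitely many
integrals over subintervals, which are compact functions of the state and tend to zero, plus a term
of order `1/N` controlled by the time derivative. -/

lemma continuous_polyEval {n d : ℕ} :
    Continuous fun z : Coeff n d × (Fin n → ℝ) => polyEval z.1 z.2 := by
  unfold polyEval
  fun_prop

namespace SymArch

variable {A : SymArch} {ε : ℝ}

/-- Induction on the depth. Restricting the parameter to `paramSet ε` keeps all denominators away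
from zero, so each quotient is continuous. -/
lemma continuous_hidden (hσ : ∀ i, 1 ≤ i → i ≤ A.L → Continuous (A.σ i)) (hε : 0 < ε) :
    ∀ (k : ℕ) (hk : k ≤ A.L),
      Continuous fun z : A.paramSet ε × (Fin (A.nσ 0) → ℝ) => A.hidden z.1.1 k hk z.2
  | 0, _ => by simpa only [hidden] using continuous_snd
  | k + 1, hk => by
    have ih := continuous_hidden hσ hε k (Nat.le_of_succ_le hk)
    simp only [hidden]
    refine (hσ (k + 1) (Nat.le_add_left 1 k) hk).comp (continuous_pi fun j => ?_)
    refine Continuous.div ?_ ?_ fun z => ?_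
    · exact continuous_polyEval.comp (Continuous.prodMk (by fun_prop) ih)
    · exact continuous_polyEval.comp (Continuous.prodMk (by fun_prop) ih)
    · exact (hε.trans_le ((z.1.2.1 ⟨k, hk⟩ j).1 _)).ne'

lemma continuous_net (hσ : ∀ i, 1 ≤ i → i ≤ A.L → Continuous (A.σ i)) (hε : 0 < ε) :
    Continuous fun z : A.paramSet ε × (Fin (A.nσ 0) → ℝ) => A.net z.1.1 z.2 := by
  have h : Continuous fun z : A.paramSet ε × (Fin (A.nσ 0) → ℝ) =>
      Fin.append (A.hidden z.1.1 A.L le_rfl z.2) z.2 := by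
    refine continuous_pi fun i => ?_
    refine Fin.addCases (fun i => ?_) (fun i => ?_) i
    · simp only [Fin.append_left]
      exact (continuous_apply i).comp (continuous_hidden hσ hε A.L le_rfl)
    · simp only [Fin.append_right]
      fun_prop
  refine Continuous.div ?_ ?_ fun z => ?_
  · exact continuous_polyEval.comp (Continuous.prodMk (by fun_prop) h)
  · exact continuous_polyEval.comp (Continuous.prodMk (by fun_prop) h)
  · exact (hε.trans_le ((z.1.2.2 0).1 _)).ne'

end SymArch

/-- A jointly continuous function depends continuously on its parameter as an element of
`L^∞` of a bounded set. -/
theorem exists_continuous_toLinfty {Θ : Type*} [TopologicalSpace Θ] {E : Type*}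
    [NormedAddCommGroup E] [NormedSpace ℝ E] [FiniteDimensional ℝ E] [MeasurableSpace E]
    [BorelSpace E] (μ : Measure E) [IsFiniteMeasureOnCompacts μ]
    {H : Θ × E → ℝ} (hH : Continuous H) {U : Set E} (hU : Bornology.IsBounded U) :
    ∃ Φ : Θ → Lp ℝ ∞ (μ.restrict U),
      (∀ θ, Φ θ =ᵐ[μ.restrict U] fun x => H (θ, x)) ∧ Continuous Φ := by
  have hK : IsCompact (closure U) := hU.isCompact_closure
  have : IsFiniteMeasure (μ.restrict U) :=
    isFiniteMeasure_restrict.2 hU.measure_lt_top.ne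
  have hae : ∀ᵐ x ∂μ.restrict U, x ∈ closure U :=
    (ae_mono (Measure.restrict_mono subset_closure le_rfl))
      (ae_restrict_mem isClosed_closure.measurableSet)
  have hc : ∀ θ, Continuous fun x => H (θ, x) := fun θ => by fun_prop
  have hmem : ∀ θ, MemLp (fun x => H (θ, x)) ∞ (μ.restrict U) := fun θ => by
    obtain ⟨C, hC⟩ := hK.exists_bound_of_continuousOn (hc θ).continuousOn
    exact memLp_top_of_bound (hc θ).aestronglyMeasurable C (hae.mono fun x hx => hC x hx)
  refine ⟨fun θ => (hmem θ).toLp _, fun θ => (hmem θ).coeFn_toLp, ?_⟩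
  refine continuous_iff_continuousAt.2 fun θ₀ => Metric.tendsto_nhds.2 fun δ hδ => ?_
  -- Tube lemma: compactness of `closure U` gives one neighbourhood of `θ₀` valid for all `x`. The
  -- essential bound only yields `≤`, hence `δ / 2`.
  have hunif : ∀ᶠ θ in 𝓝 θ₀, ∀ x ∈ closure U, dist (H (θ, x)) (H (θ₀, x)) < δ / 2 := by
    refine hK.eventually_forall_of_forall_eventually fun x _ => ?_
    have : Continuous fun z : Θ × E => dist (H (z.1, z.2)) (H (θ₀, z.2)) := by fun_prop
    have h0 := this.tendsto (θ₀, x)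
    rw [dist_self] at h0
    exact h0.eventually (gt_mem_nhds (half_pos hδ))
  filter_upwards [hunif] with θ hθ
  rw [dist_eq_norm, ← MemLp.toLp_sub]
  refine lt_of_le_of_lt (b := δ / 2) ?_ (half_lt_self hδ)
  have := Lp.norm_le_of_ae_bound (f := ((hmem θ).sub (hmem θ₀)).toLp _) (half_pos hδ).le (by
    filter_upwards [((hmem θ).sub (hmem θ₀)).coeFn_toLp, hae] with x hx hxU
    rw [hx]
    simpa [dist_eq_norm] using (hθ x hxU).le)
  simpa using this

/-! ### Superposition operators -/

/-- Bounded convergence in `L^r`. -/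
theorem tendsto_Lp_of_ae_bound {X E : Type*} [MeasurableSpace X] {μ : Measure X}
    [IsFiniteMeasure μ] [NormedAddCommGroup E] {r : ℝ≥0∞} [hr : Fact (1 ≤ r)] (hr' : r ≠ ⊤)
    {f : ℕ → Lp E r μ} {g : Lp E r μ} (C : ℝ) (hC : ∀ m, ∀ᵐ x ∂μ, ‖f m x‖ ≤ C)
    (hlim : ∀ᵐ x ∂μ, Tendsto (fun m => f m x) atTop (𝓝 (g x))) :
    Tendsto f atTop (𝓝 g) := by
  rw [Lp.tendsto_Lp_iff_tendsto_eLpNorm']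
  refine tendsto_Lp_finite_of_tendsto_ae hr.out hr' (fun m => Lp.aestronglyMeasurable _)
    (Lp.memLp g) ?_ hlim
  refine unifIntegrable_of hr.out hr' (fun m => Lp.aestronglyMeasurable _) fun δ _ => ?_
  -- The tail set is defined by a non-strict inequality, so the level must exceed `C` for the tail
  -- to be null.
  refine ⟨(C + 1).toNNReal, fun m => ?_⟩
  rw [eLpNorm_congr_ae (g := 0), eLpNorm_zero]
  · exact zero_le
  filter_upwards [hC m] with x hx
  refine Set.indicator_of_notMem (fun h => ?_) _
  have h' : (C + 1).toNNReal ≤ ‖f m x‖₊ := h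
  rw [Real.toNNReal_le_iff_le_coe, coe_nnnorm] at h'
  linarith

/-- Componentwise truncation to `[-M, M]`. -/
def clampVec {ι : Type*} (M : ℝ) (x : ι → ℝ) : ι → ℝ := fun i => max (-M) (min (x i) M)

lemma continuous_clampVec {ι : Type*} (M : ℝ) : Continuous (clampVec (ι := ι) M) := by
  unfold clampVec
  fun_prop

lemma clampVec_mem {ι : Type*} {M : ℝ} (hM : 0 ≤ M) (x : ι → ℝ) :
    clampVec M x ∈ Set.univ.pi fun _ => Set.Icc (-M) M :=
  fun i _ => ⟨le_max_left _ _, max_le (by linarith) (min_le_right _ _)⟩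

lemma clampVec_of_abs_le {ι : Type*} {M : ℝ} {x : ι → ℝ} (h : ∀ i, |x i| ≤ M) :
    clampVec M x = x := by
  funext i
  have := abs_le.1 (h i)
  rw [clampVec, min_eq_left this.2, max_eq_right this.1]

/-- Truncated superposition operators are continuous on Lebesgue spaces, jointly in the
parameter. -/
theorem exists_superposition {X : Type*} [MeasurableSpace X] {μ : Measure X} [IsFiniteMeasure μ]
    {r : ℝ≥0∞} [hr : Fact (1 ≤ r)] (hr' : r ≠ ⊤) {Θ : Type*} [TopologicalSpace Θ]
    [FirstCountableTopology Θ] {ι : Type*} [Fintype ι] {H : Θ × (ι → ℝ) → ℝ} (hH : Continuous H)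
    {M : ℝ} (hM : 0 ≤ M) :
    ∃ Φ : Θ × (ι → Lp ℝ r μ) → Lp ℝ r μ, Continuous Φ ∧
      (∀ θ y, Φ (θ, y) =ᵐ[μ] fun x => H (θ, clampVec M fun i => y i x)) ∧
      ∀ K : Set Θ, IsCompact K → ∃ C : ℝ, ∀ θ ∈ K, ∀ y, ‖Φ (θ, y)‖ ≤ C := by
  have hbox : IsCompact (Set.univ.pi fun _ : ι => Set.Icc (-M) M) :=
    isCompact_univ_pi fun _ => isCompact_Icc
  have hbd : ∀ K : Set Θ, IsCompact K →
      ∃ C : ℝ, 0 ≤ C ∧ ∀ θ ∈ K, ∀ x, ‖H (θ, clampVec M x)‖ ≤ C := fun K hK => by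
    obtain ⟨C, hC⟩ := (hK.prod hbox).exists_bound_of_continuousOn hH.continuousOn
    exact ⟨max C 0, le_max_right _ _,
      fun θ hθ x => (hC (θ, _) ⟨hθ, clampVec_mem hM x⟩).trans (le_max_left _ _)⟩
  have hmem : ∀ z : Θ × (ι → Lp ℝ r μ),
      MemLp (fun x => H (z.1, clampVec M fun i => z.2 i x)) r μ := fun z => by
    obtain ⟨C, _, hC⟩ := hbd {z.1} isCompact_singleton
    refine MemLp.of_bound ?_ C (Eventually.of_forall fun x => hC z.1 rfl _)
    have hc : Continuous fun x : ι → ℝ => H (z.1, clampVec M x) :=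
      hH.comp (continuous_const.prodMk (continuous_clampVec M))
    exact hc.comp_aestronglyMeasurable
      (aemeasurable_pi_lambda _ fun i =>
        (Lp.aestronglyMeasurable (z.2 i)).aemeasurable).aestronglyMeasurable
  refine ⟨fun z => (hmem z).toLp _, ?_, fun θ y => (hmem (θ, y)).coeFn_toLp, fun K hK => ?_⟩
  -- Convergence in `L^r` gives pointwise convergence only along subsequences, which suffices by the
  -- subsequence criterion.
  · refine continuous_iff_seqContinuous.2 fun z z' hz => tendsto_of_subseq_tendsto fun ns hns => ?_
    have hz' := hz.comp hns
    -- Refining once per coordinate produces a common subsequence for all of the finitely many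
    -- coordinates.
    have hsub : ∀ s : Finset ι, ∃ ms : ℕ → ℕ, StrictMono ms ∧ ∀ i ∈ s, ∀ᵐ x ∂μ,
        Tendsto (fun n => (z (ns (ms n))).2 i x) atTop (𝓝 (z'.2 i x)) := fun s => by
      classical
      induction s using Finset.induction_on with
      | empty => exact ⟨id, strictMono_id, by simp⟩
      | insert i s _ ih =>
        obtain ⟨ms, hms, h⟩ := ih
        have hi : Tendsto (fun n => (z (ns (ms n))).2 i) atTop (𝓝 (z'.2 i)) :=
          ((continuous_apply i).tendsto _).comp
            ((continuous_snd.tendsto _).comp (hz'.comp hms.tendsto_atTop))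
        obtain ⟨φ, hφ, hφ'⟩ := (tendstoInMeasure_of_tendsto_Lp hi).exists_seq_tendsto_ae
        refine ⟨ms ∘ φ, hms.comp hφ, fun j hj => ?_⟩
        rcases Finset.mem_insert.1 hj with rfl | hj
        · exact hφ'
        · filter_upwards [h j hj] with x hx using hx.comp hφ.tendsto_atTop
    obtain ⟨ms, hms, h⟩ := hsub Finset.univ
    refine ⟨ms, ?_⟩
    have hzm := hz'.comp hms.tendsto_atTop
    have hθ : Tendsto (fun n => (z (ns (ms n))).1) atTop (𝓝 z'.1) :=
      (continuous_fst.tendsto _).comp hzm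
    -- A convergent sequence together with its limit is compact, so one bound covers all parameters
    -- involved.
    obtain ⟨C, _, hC⟩ := hbd _ hθ.isCompact_insert_range
    refine tendsto_Lp_of_ae_bound hr' C (fun n => ?_) ?_
    · filter_upwards [(hmem (z (ns (ms n)))).coeFn_toLp] with x hx
      simp only [Function.comp_apply, hx]
      exact hC _ (Or.inr ⟨n, rfl⟩) _
    · have hall : ∀ᵐ x ∂μ, ∀ i,
          Tendsto (fun n => (z (ns (ms n))).2 i x) atTop (𝓝 (z'.2 i x)) :=
        ae_all_iff.2 fun i => h i (Finset.mem_univ i)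
      filter_upwards [hall, (hmem z').coeFn_toLp,
        ae_all_iff.2 fun n => (hmem (z (ns (ms n)))).coeFn_toLp] with x hx h1 h2
      simp only [Function.comp_apply, h1, h2]
      exact (hH.tendsto _).comp (hθ.prodMk_nhds
        (((continuous_clampVec M).tendsto _).comp (tendsto_pi_nhds.2 hx)))
  · obtain ⟨C, hC0, hC⟩ := hbd K hK
    refine ⟨_, fun θ hθ y => Lp.norm_le_of_ae_bound hC0 ?_⟩
    filter_upwards [(hmem (θ, y)).coeFn_toLp] with x hx
    rw [hx]
    exact hC θ hθ _

/-! ### Weak convergence and compact operators -/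

section compact

variable {E F G : Type*} [NormedAddCommGroup E] [NormedSpace ℝ E] [NormedAddCommGroup F]
  [NormedSpace ℝ F] [NormedAddCommGroup G] [NormedSpace ℝ G]

/-- Weakly convergent sequences are bounded. -/
theorem exists_norm_le_of_tendsto_weak {x : ℕ → E} {x' : E}
    (h : ∀ l : StrongDual ℝ E, Tendsto (fun m => l (x m)) atTop (𝓝 (l x'))) :
    ∃ C : ℝ, ∀ m, ‖x m‖ ≤ C := by
  -- Uniform boundedness is applied to evaluations on the dual, which is complete even if `E` is
  -- not.
  obtain ⟨C, hC⟩ := banach_steinhaus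
    (g := fun m => NormedSpace.inclusionInDoubleDual ℝ E (x m)) fun l => by
      obtain ⟨C, hC⟩ := (Metric.isBounded_range_of_tendsto _ (h l)).exists_norm_le
      exact ⟨C, fun m => hC _ ⟨m, rfl⟩⟩
  refine ⟨C, fun m => ?_⟩
  rw [← (NormedSpace.inclusionInDoubleDualLi (E := E) ℝ).norm_map (x m)]
  exact hC m

/-- Compact operators map weakly convergent sequences to convergent sequences. -/
theorem IsCompactOperator.tendsto_of_tendsto_weak {K : E →L[ℝ] F} (hK : IsCompactOperator K)
    {x : ℕ → E} {x' : E}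
    (h : ∀ l : StrongDual ℝ E, Tendsto (fun m => l (x m)) atTop (𝓝 (l x'))) :
    Tendsto (fun m => K (x m)) atTop (𝓝 (K x')) := by
  obtain ⟨C, hC⟩ := exists_norm_le_of_tendsto_weak h
  have hcpt := hK.isCompact_closure_image_closedBall (f := (K : E →ₗ[ℝ] F)) C
  have hmem : ∀ m, K (x m) ∈ closure (K '' Metric.closedBall 0 C) := fun m =>
    subset_closure ⟨x m, by simpa using hC m, rfl⟩
  refine tendsto_of_subseq_tendsto fun ns hns => ?_
  obtain ⟨y, -, ms, hms, hy⟩ := hcpt.tendsto_subseq fun n => hmem (ns n)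
  -- Every cluster point is `K x'`, because `l ∘ K` is a functional on `E` for each functional `l`
  -- on `F`.
  have hyx : y = K x' := by
    refine SeparatingDual.eq_iff_forall_dual_eq (R := ℝ) |>.2 fun l => ?_
    refine tendsto_nhds_unique ((l.continuous.tendsto y).comp hy) ?_
    exact (h (l ∘L K)).comp (hns.comp hms.tendsto_atTop)
  exact ⟨ms, hyx ▸ hy⟩

/-- Ehrling's inequality. -/
theorem IsCompactOperator.exists_norm_le_add {K : E →L[ℝ] F} (hK : IsCompactOperator K)
    {j : F →L[ℝ] G} (hj : Function.Injective j) {η : ℝ} (hη : 0 < η) :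
    ∃ C : ℝ, 0 ≤ C ∧ ∀ x, ‖K x‖ ≤ η * ‖x‖ + C * ‖j (K x)‖ := by
  by_contra! hcon
  have hcon' : ∀ n : ℕ, ∃ x, η * ‖x‖ + n * ‖j (K x)‖ < ‖K x‖ := fun n => hcon n n.cast_nonneg
  choose x hx using hcon'
  have hpos : ∀ n, 0 < ‖K (x n)‖ := fun n => lt_of_le_of_lt (by positivity) (hx n)
  -- Normalised counterexamples: `‖K y‖ = 1`, `‖y‖ ≤ 1/η` and `‖j (K y)‖ ≤ 1/n`. A limit of `K y`
  -- along a subsequence is a unit vector in the kernel of `j`.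
  set y : ℕ → E := fun n => ‖K (x n)‖⁻¹ • x n with hy
  have hKy : ∀ n, ‖K (y n)‖ = 1 := fun n => by
    rw [hy, map_smul, norm_smul, norm_inv, norm_norm, inv_mul_cancel₀ (hpos n).ne']
  have hyn : ∀ n, η * ‖y n‖ + n * ‖j (K (y n))‖ ≤ 1 := fun n => by
    have : η * ‖y n‖ + n * ‖j (K (y n))‖ =
        ‖K (x n)‖⁻¹ * (η * ‖x n‖ + n * ‖j (K (x n))‖) := by
      simp only [hy, map_smul, norm_smul, norm_inv, norm_norm]
      ring
    rw [this, inv_mul_le_iff₀ (hpos n), mul_one]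
    exact (hx n).le
  have hy1 : ∀ n, ‖y n‖ ≤ η⁻¹ := fun n => by
    have h0 : 0 ≤ (n : ℝ) * ‖j (K (y n))‖ := by positivity
    rw [← one_div, le_div_iff₀' hη]
    linarith [hyn n]
  have hcpt := hK.isCompact_closure_image_closedBall (f := (K : E →ₗ[ℝ] F)) η⁻¹
  obtain ⟨b, -, ms, hms, hb⟩ := hcpt.tendsto_subseq (x := fun n => K (y n)) fun n =>
    subset_closure ⟨y n, by simpa using hy1 n, rfl⟩
  have hb1 : ‖b‖ = 1 := tendsto_nhds_unique hb.norm (by simp [hKy])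
  have hjb : j b = 0 := by
    refine tendsto_nhds_unique ((j.continuous.tendsto b).comp hb) ?_
    refine squeeze_zero_norm' (a := fun n => (1 : ℝ) / (ms n : ℝ)) ?_
      ((tendsto_const_div_atTop_nhds_zero_nat 1).comp hms.tendsto_atTop)
    filter_upwards [eventually_gt_atTop 0] with n hn
    have hmn : (0 : ℝ) < ms n := Nat.cast_pos.2 (hn.trans_le (hms.id_le n))
    have h0 : 0 ≤ η * ‖y (ms n)‖ := by positivity
    rw [le_div_iff₀' hmn]
    simp only [Function.comp_apply]
    linarith [hyn (ms n)]
  have : b = 0 := hj (by rw [hjb, map_zero])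
  simp [this] at hb1

end compact

/-! ### Functions with integrable time derivative -/

lemma timeMeasure_eq (T : ℝ) : timeMeasure T = volume.restrict (Set.Ioc 0 T) :=
  Measure.restrict_congr_set Ioo_ae_eq_Ioc

lemma integrable_timeMeasure_iff {E : Type*} [NormedAddCommGroup E] {T : ℝ} (hT : 0 < T) {g : ℝ → E} :
    Integrable g (timeMeasure T) ↔ IntervalIntegrable g volume 0 T := by
  rw [timeMeasure_eq, intervalIntegrable_iff_integrableOn_Ioc_of_le hT.le, IntegrableOn]

lemma intervalIntegrable_of_timeMeasure {E : Type*} [NormedAddCommGroup E] {T a b : ℝ} (hT : 0 < T) (ha : a ∈ Set.Icc 0 T)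
    (hb : b ∈ Set.Icc 0 T) {g : ℝ → E} (hg : Integrable g (timeMeasure T)) :
    IntervalIntegrable g volume a b := by
  refine ((integrable_timeMeasure_iff hT).1 hg).mono_set ?_
  rw [Set.uIcc_of_le hT.le]
  exact Set.uIcc_subset_Icc ha hb

section time

variable {E : Type*} [NormedAddCommGroup E] [NormedSpace ℝ E]

/-- A test function with vanishing integral is the derivative of a test function. -/
theorem IsTest.exists_deriv_eq {T : ℝ} (hT : 0 < T) {φ : ℝ → ℝ} (hφ : IsTest (Set.Ioo 0 T) φ)
    (h0 : ∫ t, φ t = 0) : ∃ ψ, IsTest (Set.Ioo 0 T) ψ ∧ deriv ψ = φ := by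
  -- The compact support stays away from both endpoints, and the primitive will be supported in the
  -- same `[a, b]`.
  obtain ⟨a, b, ha, hb, hab⟩ : ∃ a b, 0 < a ∧ b < T ∧ tsupport φ ⊆ Set.Icc a b := by
    rcases (tsupport φ).eq_empty_or_nonempty with he | hne
    · exact ⟨T / 2, T / 2, half_pos hT, half_lt_self hT, by simp [he]⟩
    · obtain ⟨a, ha⟩ := hφ.2.1.isCompact.exists_isLeast hne
      obtain ⟨b, hb⟩ := hφ.2.1.isCompact.exists_isGreatest hne
      exact ⟨a, b, (hφ.2.2 ha.1).1, (hφ.2.2 hb.1).2, fun x hx => ⟨ha.2 hx, hb.2 hx⟩⟩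
  have hsupp : ∀ x, φ x ≠ 0 → x ∈ Set.Icc a b := fun x hx => hab (subset_tsupport _ hx)
  set ψ : ℝ → ℝ := fun t => ∫ s in (0 : ℝ)..t, φ s with hψ
  have hder : ∀ t, HasDerivAt ψ (φ t) t := fun t =>
    hφ.1.continuous.integral_hasStrictDerivAt 0 t |>.hasDerivAt
  have hderiv : deriv ψ = φ := funext fun t => (hder t).deriv
  -- To the left of `a` the integrand vanishes. To the right of `b` the primitive is the whole
  -- integral, which is zero by `h0`.
  have hψ0 : ∀ t, t ∉ Set.Icc a b → ψ t = 0 := fun t ht => by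
    rcases lt_or_ge t a with hta | hta
    · refine intervalIntegral.integral_zero_ae (Eventually.of_forall fun s hs => ?_)
      by_contra hs0
      have h1 := (hsupp s hs0).1
      rcases Set.mem_uIoc.1 hs with h | h
      · linarith [h.2]
      · linarith [h.2]
    · have htb : b < t := not_le.1 fun h => ht ⟨hta, h⟩
      rw [hψ]
      dsimp only
      rw [intervalIntegral.integral_eq_integral_of_support_subset, h0]
      intro s hs
      have := hsupp s hs
      exact ⟨ha.trans_le this.1, this.2.trans htb.le⟩
  have hts : tsupport ψ ⊆ Set.Icc a b :=
    closure_minimal (fun t ht => by_contra fun h => ht (hψ0 t h)) isClosed_Icc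
  refine ⟨ψ, ⟨?_, HasCompactSupport.intro isCompact_Icc hψ0, fun t ht => ?_⟩, hderiv⟩
  · refine contDiff_infty_iff_deriv.2 ⟨fun t => (hder t).differentiableAt, ?_⟩
    rw [hderiv]
    exact hφ.1
  · exact ⟨ha.trans_le (hts ht).1, (hts ht).2.trans_lt hb⟩

/-- A normalised bump centred at `T / 2`, with outer radius `T / 3 < T / 2`. It serves to remove the
mean of a test function in the du Bois-Reymond lemma. -/
theorem IsTest.exists_integral_eq_one {T : ℝ} (hT : 0 < T) :
    ∃ φ, IsTest (Set.Ioo 0 T) φ ∧ ∫ t, φ t = 1 := by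
  let f : ContDiffBump (T / 2) := ⟨T / 4, T / 3, by linarith, by linarith⟩
  refine ⟨f.normed volume, ⟨f.contDiff_normed, f.hasCompactSupport_normed, ?_⟩,
    f.integral_normed⟩
  rw [f.tsupport_normed_eq, Real.closedBall_eq_Icc]
  intro t ht
  have h1 : T / 2 - T / 3 ≤ t := ht.1
  have h2 : t ≤ T / 2 + T / 3 := ht.2
  constructor <;> linarith

lemma integrable_smul_of_hasCompactSupport {u : ℝ → E} {φ : ℝ → ℝ} {μ : Measure ℝ}
    (hu : Integrable u μ) (hc : Continuous φ) (hs : HasCompactSupport φ) :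
    Integrable (fun t => φ t • u t) μ := by
  obtain ⟨C, hC⟩ := hs.exists_bound_of_continuous hc
  exact hu.bdd_smul (φ := φ) C hc.aestronglyMeasurable (Eventually.of_forall hC)

lemma IsTest.setIntegral_smul {U : Set ℝ} {φ : ℝ → ℝ} (hφ : IsTest U φ) (u : ℝ → E) :
    ∫ t in U, φ t • u t = ∫ t, φ t • u t :=
  setIntegral_eq_integral_of_forall_compl_eq_zero fun t ht => by
    rw [image_eq_zero_of_notMem_tsupport fun h => ht (hφ.2.2 h), zero_smul]

/-- The du Bois-Reymond lemma. -/
theorem ae_eq_const_of_isTimeDeriv_zero [CompleteSpace E] {T : ℝ} (hT : 0 < T) {u : ℝ → E}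
    (hu : Integrable u (timeMeasure T)) (h : IsTimeDeriv T u 0) :
    ∃ c : E, ∀ᵐ t ∂timeMeasure T, u t = c := by
  obtain ⟨χ, hχ, hχ1⟩ := IsTest.exists_integral_eq_one hT
  -- Testing a constant function against `χ` returns the constant, so this is the only candidate.
  set c : E := ∫ t in Set.Ioo 0 T, χ t • u t with hc
  refine ⟨c, ?_⟩
  have hint : Integrable (fun t => u t - c) (timeMeasure T) := hu.sub (integrable_const c)
  have key := IsOpen.ae_eq_zero_of_integral_contDiff_smul_eq_zero (μ := volume)
    (isOpen_Ioo (a := (0 : ℝ)) (b := T)) (f := fun t => u t - c)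
    (IntegrableOn.locallyIntegrableOn hint) fun φ h1 h2 h3 => by
      have hφ : IsTest (Set.Ioo 0 T) φ := ⟨h1, h2, h3⟩
      set m : ℝ := ∫ t, φ t with hm
      have hφi : Integrable φ := hφ.1.continuous.integrable_of_hasCompactSupport hφ.2.1
      have hχi : Integrable χ := hχ.1.continuous.integrable_of_hasCompactSupport hχ.2.1
      -- This function has mean zero, hence is the derivative of a test function. The hypothesis
      -- then says `∫ φ u = m c = ∫ φ c`.
      have hω : IsTest (Set.Ioo 0 T) fun t => φ t - m * χ t := by
        refine ⟨hφ.1.sub (contDiff_const.mul hχ.1), hφ.2.1.sub (hχ.2.1.mul_left), ?_⟩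
        refine (tsupport_sub _ _).trans (Set.union_subset hφ.2.2 ?_)
        exact (tsupport_mul_subset_right).trans hχ.2.2
      obtain ⟨ψ, hψ, hψd⟩ := hω.exists_deriv_eq hT (by
        rw [integral_sub hφi (hχi.const_mul m), integral_const_mul, hχ1, mul_one, sub_self])
      have e := h ψ hψ
      rw [hψd] at e
      simp only [Pi.zero_apply, smul_zero, integral_zero, neg_zero, sub_smul, mul_smul] at e
      have i1 := integrable_smul_of_hasCompactSupport hu hφ.1.continuous hφ.2.1
      have i2 := integrable_smul_of_hasCompactSupport hu hχ.1.continuous hχ.2.1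
      rw [integral_sub i1 (g := fun t => m • χ t • u t) (i2.smul m), integral_smul, ← hc, sub_eq_zero] at e
      rw [← hφ.setIntegral_smul]
      simp only [smul_sub]
      have e3 : ∫ t in Set.Ioo 0 T, φ t • c = m • c := by
        rw [hφ.setIntegral_smul, integral_smul_const]
      rw [integral_sub i1 (integrable_smul_of_hasCompactSupport (integrable_const c)
        hφ.1.continuous hφ.2.1), e, e3, sub_self]
  rw [ae_restrict_iff' measurableSet_Ioo]
  filter_upwards [key] with t ht h'
  exact sub_eq_zero.1 (ht h')

/-- Antiderivatives of integrable functions are weakly differentiable. -/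
theorem isTimeDeriv_integral [CompleteSpace E] {T : ℝ} {g : ℝ → E}
    (hg : Integrable g (timeMeasure T)) :
    IsTimeDeriv T (fun t => ∫ s in (0 : ℝ)..t, g s) g := by
  intro φ hφ
  have hd : Continuous (deriv φ) := hφ.1.continuous_deriv (by simp)
  have hdi : Integrable (deriv φ) (timeMeasure T) :=
    (hd.integrable_of_hasCompactSupport hφ.2.1.deriv).restrict
  -- Fubini on the triangle `s ≤ t`: exchanging the order leaves the integral of `deriv φ` over `[s,
  -- T)`, which is `-φ s` since `φ T = 0`.
  have hF : Integrable (Function.uncurry fun t s : ℝ =>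
      (Set.Iic t).indicator (fun s => deriv φ t • g s) s)
      ((timeMeasure T).prod (timeMeasure T)) := by
    have h1 := (hdi.smul_prod hg).indicator
      (measurableSet_le measurable_snd measurable_fst : MeasurableSet {z : ℝ × ℝ | z.2 ≤ z.1})
    refine h1.congr (Eventually.of_forall fun z => ?_)
    simp [Set.indicator, Function.uncurry]
  have hsw := integral_integral_swap hF
  have hL : ∫ t in Set.Ioo 0 T, deriv φ t • ∫ s in (0 : ℝ)..t, g s =
      ∫ t in Set.Ioo 0 T, ∫ s in Set.Ioo 0 T,
        (Set.Iic t).indicator (fun s => deriv φ t • g s) s := by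
    refine setIntegral_congr_fun measurableSet_Ioo fun t ht => ?_
    rw [integral_indicator measurableSet_Iic, Measure.restrict_restrict measurableSet_Iic,
      integral_smul, intervalIntegral.integral_of_le ht.1.le]
    congr 3
    ext s
    simp only [Set.mem_inter_iff, Set.mem_Iic, Set.mem_Ioo, Set.mem_Ioc]
    exact ⟨fun h => ⟨h.2, h.1, h.2.trans_lt ht.2⟩, fun h => ⟨h.2.1, h.1⟩⟩
  rw [hL, hsw, ← integral_neg]
  refine setIntegral_congr_fun measurableSet_Ioo fun s hs => ?_
  have h1 : ∀ t, (Set.Iic t).indicator (fun s => deriv φ t • g s) s =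
      (Set.Ici s).indicator (deriv φ) t • g s := fun t => by
    by_cases h : s ≤ t <;> simp [Set.indicator, h]
  have h2 : Set.Ici s ∩ Set.Ioo 0 T = Set.Ico s T := by
    ext t
    simp only [Set.mem_inter_iff, Set.mem_Ici, Set.mem_Ioo, Set.mem_Ico]
    exact ⟨fun h => ⟨h.1, h.2.2⟩, fun h => ⟨h.1, hs.1.trans_le h.1, h.2⟩⟩
  have h3 : φ T = 0 := image_eq_zero_of_notMem_tsupport fun h => (hφ.2.2 h).2.false
  simp only [h1]
  rw [integral_smul_const, integral_indicator measurableSet_Ici,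
    Measure.restrict_restrict measurableSet_Ici, h2, integral_Ico_eq_integral_Ioc,
    ← intervalIntegral.integral_of_le hs.2.le, intervalIntegral.integral_deriv_eq_sub
      (fun t _ => (hφ.1.differentiable (by simp)) t) (hd.intervalIntegrable _ _), h3, zero_sub,
    neg_smul]

/-- A function with integrable time derivative is an antiderivative of it. -/
theorem IsTimeDeriv.exists_ae_eq [CompleteSpace E] {T : ℝ} (hT : 0 < T) {u g : ℝ → E}
    (hu : Integrable u (timeMeasure T)) (hg : Integrable g (timeMeasure T))
    (h : IsTimeDeriv T u g) :
    ∃ c : E, ∀ᵐ t ∂timeMeasure T, u t = c + ∫ s in (0 : ℝ)..t, g s := by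
  have hG : Integrable (fun t => ∫ s in (0 : ℝ)..t, g s) (timeMeasure T) := by
    rw [timeMeasure_eq]
    refine IntegrableOn.mono_set (t := Set.Icc 0 T) ?_ Set.Ioc_subset_Icc_self
    have hc := intervalIntegral.continuousOn_primitive_interval (μ := volume) (f := g) (a := 0)
      (b := T) (by
        rw [Set.uIcc_of_le hT.le, integrableOn_Icc_iff_integrableOn_Ioo]
        exact hg)
    rw [Set.uIcc_of_le hT.le] at hc
    exact hc.integrableOn_Icc
  -- The difference of `u` and the primitive of `g` has zero weak derivative.
  obtain ⟨c, hc⟩ := ae_eq_const_of_isTimeDeriv_zero hT (hu.sub hG) fun φ hφ => by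
    have hd : Continuous (deriv φ) := hφ.1.continuous_deriv (by simp)
    have e1 := h φ hφ
    have e2 := isTimeDeriv_integral hg φ hφ
    simp only [Pi.sub_apply, smul_sub, Pi.zero_apply, smul_zero, integral_zero, neg_zero]
    rw [integral_sub (integrable_smul_of_hasCompactSupport hu hd hφ.2.1.deriv)
      (integrable_smul_of_hasCompactSupport hG hd hφ.2.1.deriv), e1, e2, sub_self]
  refine ⟨c, hc.mono fun t ht => ?_⟩
  rw [← ht, Pi.sub_apply, sub_add_cancel]

/-- Poincaré's inequality on a subinterval. -/
theorem IsTimeDeriv.integral_norm_le [CompleteSpace E] {T : ℝ} (hT : 0 < T) {u g : ℝ → E}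
    (hu : Integrable u (timeMeasure T)) (hg : Integrable g (timeMeasure T))
    (h : IsTimeDeriv T u g) {a b : ℝ} (ha : 0 ≤ a) (hab : a < b) (hb : b ≤ T) :
    ∫ t in a..b, ‖u t‖ ≤ ‖∫ t in a..b, u t‖ + (b - a) * ∫ t in a..b, ‖g t‖ := by
  have hba : 0 < b - a := sub_pos.2 hab
  obtain ⟨c, hc⟩ := h.exists_ae_eq hT hu hg
  have hI : ∀ x ∈ Set.Ioc a b, x ∈ Set.Icc 0 T := fun x hx =>
    ⟨ha.trans hx.1.le, hx.2.trans hb⟩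
  have ha' : a ∈ Set.Icc 0 T := ⟨ha, hab.le.trans hb⟩
  have hb' : b ∈ Set.Icc 0 T := ⟨ha.trans hab.le, hb⟩
  have h0' : (0 : ℝ) ∈ Set.Icc 0 T := ⟨le_rfl, hT.le⟩
  have hui := intervalIntegrable_of_timeMeasure hT ha' hb' hu
  have hgi := intervalIntegrable_of_timeMeasure hT ha' hb' hg
  rw [timeMeasure_eq] at hc
  have hc' : ∀ᵐ t ∂volume.restrict (Set.Ioc a b), u t = c + ∫ s in (0 : ℝ)..t, g s :=
    ae_restrict_of_ae_restrict_of_subset (Set.Ioc_subset_Ioc ha hb) hc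
  have hc'' := (ae_restrict_iff' measurableSet_Ioc).1 hc'
  set Γ := ∫ t in a..b, ‖g t‖ with hΓ
  -- The oscillation of the primitive on `(a, b]` is at most the integral of `‖g‖` there.
  have hdiff : ∀ t ∈ Set.Ioc a b, ∀ s ∈ Set.Ioc a b,
      ‖(∫ r in (0 : ℝ)..t, g r) - ∫ r in (0 : ℝ)..s, g r‖ ≤ Γ := fun t ht s hs => by
    rw [intervalIntegral.integral_interval_sub_left
      (intervalIntegrable_of_timeMeasure hT h0' (hI t ht) hg)
      (intervalIntegrable_of_timeMeasure hT h0' (hI s hs) hg)]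
    refine intervalIntegral.norm_integral_le_integral_norm_uIoc.trans ?_
    rw [hΓ, intervalIntegral.integral_of_le hab.le]
    refine setIntegral_mono_set ((intervalIntegrable_iff_integrableOn_Ioc_of_le hab.le).1 hgi.norm)
      (Eventually.of_forall fun _ => norm_nonneg _) (LE.le.eventuallyLE ?_)
    intro x hx
    rcases Set.mem_uIoc.1 hx with h | h
    · exact ⟨hs.1.trans h.1, h.2.trans ht.2⟩
    · exact ⟨ht.1.trans h.1, h.2.trans hs.2⟩
  have hpt : ∀ᵐ t ∂volume, t ∈ Set.Ioc a b →
      ‖u t‖ ≤ (b - a)⁻¹ * ‖∫ s in a..b, u s‖ + Γ := by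
    filter_upwards [hc''] with t ht htI
    -- Integrating in `s` compares `(b - a) • u t` with the integral of `u`, so `u t` is within `Γ`
    -- of the mean.
    have h1 : ‖∫ s in a..b, (u t - u s)‖ ≤ Γ * |b - a| := by
      refine intervalIntegral.norm_integral_le_of_norm_le_const_ae ?_
      rw [Set.uIoc_of_le hab.le]
      filter_upwards [hc''] with s hs hsI
      rw [ht htI, hs hsI, add_sub_add_left_eq_sub]
      exact hdiff t htI s hsI
    rw [intervalIntegral.integral_sub intervalIntegrable_const hui,
      intervalIntegral.integral_const, abs_of_pos hba] at h1
    have h2 : (b - a) * ‖u t‖ ≤ ‖∫ s in a..b, u s‖ + Γ * (b - a) := by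
      have := norm_le_norm_add_norm_sub' ((b - a) • u t) (∫ s in a..b, u s)
      rw [norm_smul, Real.norm_of_nonneg hba.le] at this
      linarith
    rw [← mul_le_mul_iff_right₀ hba, mul_add, mul_inv_cancel_left₀ hba.ne']
    linarith
  calc ∫ t in a..b, ‖u t‖ ≤ ∫ t in a..b, ((b - a)⁻¹ * ‖∫ s in a..b, u s‖ + Γ) := by
        rw [intervalIntegral.integral_of_le hab.le, intervalIntegral.integral_of_le hab.le]
        refine integral_mono_ae ((intervalIntegrable_iff_integrableOn_Ioc_of_le hab.le).1 hui.norm)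
          (integrable_const _) ?_
        exact (ae_restrict_iff' measurableSet_Ioc).2 hpt
    _ = _ := by
        rw [intervalIntegral.integral_const, smul_eq_mul, mul_add, mul_inv_cancel_left₀ hba.ne']

/-- Poincaré's inequality for a partition of `[0, T]` into `N` intervals of equal length. -/
theorem IsTimeDeriv.integral_norm_le_sum [CompleteSpace E] {T : ℝ} (hT : 0 < T) {u g : ℝ → E}
    (hu : Integrable u (timeMeasure T)) (hg : Integrable g (timeMeasure T))
    (h : IsTimeDeriv T u g) {N : ℕ} (hN : 0 < N) :
    ∫ t, ‖u t‖ ∂timeMeasure T ≤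
      (∑ i ∈ Finset.range N, ‖∫ t in (i * (T / N))..((i + 1 : ℕ) * (T / N)), u t‖) +
        T / N * ∫ t, ‖g t‖ ∂timeMeasure T := by
  have hN' : (0 : ℝ) < N := Nat.cast_pos.2 hN
  have hs : 0 < T / N := div_pos hT hN'
  have hmem : ∀ i ≤ N, (i : ℝ) * (T / N) ∈ Set.Icc 0 T := fun i hi => by
    refine ⟨by positivity, ?_⟩
    calc (i : ℝ) * (T / N) ≤ N * (T / N) := by gcongr
      _ = T := by field_simp
  have hsplit : ∀ {f : ℝ → ℝ}, Integrable f (timeMeasure T) →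
      ∫ t, f t ∂timeMeasure T =
        ∑ i ∈ Finset.range N, ∫ t in (i * (T / N))..((i + 1 : ℕ) * (T / N)), f t := fun hf => by
    rw [intervalIntegral.sum_integral_adjacent_intervals (a := fun i : ℕ => (i : ℝ) * (T / N))
      fun i hi => intervalIntegrable_of_timeMeasure hT (hmem i hi.le) (hmem (i + 1) hi) hf]
    rw [timeMeasure_eq, ← intervalIntegral.integral_of_le hT.le]
    congr 1
    · simp
    · field_simp
  rw [hsplit hu.norm, hsplit hg.norm, Finset.mul_sum, ← Finset.sum_add_distrib]
  refine Finset.sum_le_sum fun i hi => ?_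
  have hi' : i < N := Finset.mem_range.1 hi
  have hlen : ((i + 1 : ℕ) : ℝ) * (T / N) - i * (T / N) = T / N := by push_cast; ring
  have := h.integral_norm_le hT hu hg (hmem i hi'.le).1
    (sub_pos.1 (by rw [hlen]; exact hs)) (hmem (i + 1) hi').2
  rwa [hlen] at this

end time

/-! ### Inclusions of Lebesgue and Sobolev spaces -/

/-- The inclusion `L^p ⊆ L^q`, `q ≤ p`, for a finite measure. -/
theorem exists_inclusion_Lp {X E : Type*} [MeasurableSpace X] (μ : Measure X) [IsFiniteMeasure μ]
    [NormedAddCommGroup E] [NormedSpace ℝ E] {p q : ℝ≥0∞} [Fact (1 ≤ p)] [Fact (1 ≤ q)]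
    (hqp : q ≤ p) :
    ∃ I : Lp E p μ →L[ℝ] Lp E q μ, ∀ f, I f =ᵐ[μ] f := by
  have hmem : ∀ f : Lp E p μ, MemLp f q μ := fun f => (Lp.memLp f).mono_exponent hqp
  let L : Lp E p μ →ₗ[ℝ] Lp E q μ :=
    { toFun := fun f => (hmem f).toLp _
      map_add' := fun f g => by
        rw [← MemLp.toLp_add]
        exact MemLp.toLp_congr _ _ (Lp.coeFn_add f g)
      map_smul' := fun c f => by
        rw [RingHom.id_apply, ← MemLp.toLp_const_smul]
        exact MemLp.toLp_congr _ _ (Lp.coeFn_smul c f) }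
  -- The exponent of the total mass must be nonnegative for the constant to be finite. For `p = ⊤`
  -- the convention `⊤.toReal = 0` makes it `1 / q.toReal`.
  have hexp : 0 ≤ 1 / q.toReal - 1 / p.toReal ∨ p = ⊤ := by
    by_cases hp : p = ⊤
    · exact Or.inr hp
    refine Or.inl (sub_nonneg.2 ?_)
    have h1 : (1 : ℝ) ≤ q.toReal := by
      have := ENNReal.toReal_mono (ne_top_of_le_ne_top hp hqp) (Fact.out : 1 ≤ q)
      simpa using this
    exact one_div_le_one_div_of_le (by linarith) (ENNReal.toReal_mono hp hqp)
  have hfin : μ Set.univ ^ (1 / q.toReal - 1 / p.toReal) ≠ ⊤ := by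
    refine ENNReal.rpow_ne_top_of_nonneg ?_ (measure_ne_top _ _)
    rcases hexp with h | h
    · exact h
    · simp [h]
  refine ⟨L.mkContinuous (μ Set.univ ^ (1 / q.toReal - 1 / p.toReal)).toReal fun f => ?_,
    fun f => (hmem f).coeFn_toLp⟩
  change ‖(hmem f).toLp _‖ ≤ _
  rw [Lp.norm_toLp, Lp.norm_def, mul_comm, ← ENNReal.toReal_mul]
  exact ENNReal.toReal_mono (ENNReal.mul_ne_top (Lp.eLpNorm_ne_top f) hfin)
    (eLpNorm_le_eLpNorm_mul_rpow_measure_univ hqp (Lp.aestronglyMeasurable f))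

/-- On a finite measure space, the integral over a set is a bounded operator on `L^p`. -/
theorem exists_setIntegral_clm {X E : Type*} [MeasurableSpace X] (μ : Measure X)
    [IsFiniteMeasure μ] [NormedAddCommGroup E] [NormedSpace ℝ E] {p : ℝ≥0∞}
    [hp : Fact (1 ≤ p)] (s : Set X) :
    ∃ I : Lp E p μ →L[ℝ] E, ∀ f, I f = ∫ x in s, f x ∂μ := by
  obtain ⟨J, hJ⟩ := exists_inclusion_Lp (E := E) μ hp.out
  let L : Lp E 1 μ →ₗ[ℝ] E :=
    { toFun := fun f => ∫ x in s, f x ∂μ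
      map_add' := fun f g => by
        rw [← integral_add (L1.integrable_coeFn f).integrableOn (L1.integrable_coeFn g).integrableOn]
        exact integral_congr_ae (ae_restrict_of_ae (Lp.coeFn_add f g))
      map_smul' := fun c f => by
        rw [RingHom.id_apply, ← integral_smul]
        exact integral_congr_ae (ae_restrict_of_ae (Lp.coeFn_smul c f)) }
  refine ⟨(⟨L, continuous_setIntegral s⟩ : Lp E 1 μ →L[ℝ] E) ∘L J, fun f => ?_⟩
  exact integral_congr_ae (ae_restrict_of_ae (hJ f))

/-- The constant is the operator norm of the inclusion of `L^p` in `L^1`. -/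
theorem exists_integral_norm_le {X E : Type*} [MeasurableSpace X] (μ : Measure X)
    [IsFiniteMeasure μ] [NormedAddCommGroup E] [NormedSpace ℝ E] {p : ℝ≥0∞}
    [hp : Fact (1 ≤ p)] :
    ∃ C : ℝ, 0 ≤ C ∧ ∀ f : Lp E p μ, ∫ x, ‖f x‖ ∂μ ≤ C * ‖f‖ := by
  obtain ⟨J, hJ⟩ := exists_inclusion_Lp (E := E) μ hp.out
  refine ⟨‖J‖, norm_nonneg _, fun f => ?_⟩
  refine le_trans (le_of_eq ?_) (J.le_opNorm f)
  rw [L1.norm_eq_integral_norm]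
  exact integral_congr_ae ((hJ f).mono fun x hx => by simp only [hx])

/-- Weak derivatives are unique. -/
theorem SobolevSpace.val_injective {d κ : ℕ} {p : ℝ≥0∞} [hp : Fact (1 ≤ p)]
    {Ω : Set (EuclideanSpace ℝ (Fin d))} (hΩ : IsOpen Ω) :
    Function.Injective (SobolevSpace.val : SobolevSpace κ p Ω →L[ℝ] _) := by
  refine (injective_iff_map_eq_zero _).2 fun f hf => ?_
  have hf1 : f.1.1 = 0 := hf
  refine Subtype.ext (Prod.ext hf1 (funext fun k => funext fun β => ?_))
  have hw := f.2 k β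
  rw [hf1] at hw
  have hli : LocallyIntegrableOn (f.1.2 k β) Ω volume := by
    rw [locallyIntegrableOn_iff hΩ.isLocallyClosed]
    intro K hK hKc
    have h1 : MemLp (f.1.2 k β) p (volume.restrict K) :=
      (Lp.memLp (f.1.2 k β)).mono_measure (Measure.restrict_mono hK le_rfl)
    have : IsFiniteMeasure (volume.restrict K) := isFiniteMeasure_restrict.2 hKc.measure_lt_top.ne
    exact memLp_one_iff_integrable.1 (h1.mono_exponent hp.out)
  -- If the function is zero, its weak derivative integrates to zero against every test function, up
  -- to the sign `(-1)^k`.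
  have key := hΩ.ae_eq_zero_of_integral_contDiff_smul_eq_zero hli fun φ h1 h2 h3 => by
    have e := hw φ ⟨h1, h2, h3⟩
    have e0 : ∫ x in Ω, (0 : Lp ℝ p (volume.restrict Ω)) x *
        multiDeriv (fun i => (β.1 i : ℕ)) φ x = 0 := by
      refine integral_eq_zero_of_ae ?_
      filter_upwards [Lp.coeFn_zero ℝ p (volume.restrict Ω)] with x hx
      rw [hx, Pi.zero_apply, zero_mul]
    rw [e0] at e
    have e1 := (mul_eq_zero.1 e.symm).resolve_left (pow_ne_zero _ (by norm_num))
    rw [← e1, setIntegral_eq_integral_of_forall_compl_eq_zero fun x hx => by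
      rw [image_eq_zero_of_notMem_tsupport fun h => hx (h3 h), mul_zero]]
    exact integral_congr_ae (Eventually.of_forall fun x => by simp [mul_comm])
  refine Lp.ext ?_
  filter_upwards [(ae_restrict_iff' hΩ.measurableSet).2 key,
    Lp.coeFn_zero ℝ p (volume.restrict Ω)] with x hx h0
  rw [hx]
  exact h0.symm

lemma injective_clm_comp {E F G : Type*} [NormedAddCommGroup E] [NormedSpace ℝ E]
    [NormedAddCommGroup F] [NormedSpace ℝ F] [NormedAddCommGroup G] [NormedSpace ℝ G]
    {f : E →L[ℝ] F} {g : F →L[ℝ] G} (hf : Function.Injective f) (hg : Function.Injective g) :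
    Function.Injective (g ∘L f) :=
  fun _ _ h => hf (hg h)

/-! ### Aubin–Lions compactness in the state space -/

namespace SpaceMaps

variable {d κ : ℕ} {Ω : Set (EuclideanSpace ℝ (Fin d))} {p' q' : ℝ≥0∞}
  [Fact (1 ≤ p')] [Fact (1 ≤ q')] {V V' W : Type*} {Vk : Fin κ → Type*}
  [NormedAddCommGroup V] [NormedSpace ℝ V] [NormedAddCommGroup V'] [NormedSpace ℝ V']
  [NormedAddCommGroup W] [NormedSpace ℝ W]
  [∀ k, NormedAddCommGroup (Vk k)] [∀ k, NormedSpace ℝ (Vk k)]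
  {S : SpaceMaps κ Ω p' q' V V' W Vk} {T : ℝ} {p q : ℝ≥0∞} [Fact (1 ≤ p)]

/-- `L^p̂(Ω)` embeds into `W`. -/
theorem IsSetup.exists_lpToW (hS : S.IsSetup T p q) :
    ∃ J : Lp ℝ p' (volume.restrict Ω) →L[ℝ] W, Function.Injective J ∧
      ∀ v, J (SobolevSpace.val (S.toSob v)) = S.v'ToW (S.toV' v) := by
  have : IsFiniteMeasure (volume.restrict Ω) :=
    isFiniteMeasure_restrict.2 hS.isBounded.measure_lt_top.ne
  obtain ⟨I, hI⟩ := exists_inclusion_Lp (E := ℝ) (volume.restrict Ω) hS.q'_le_p'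
  refine ⟨S.lqToW ∘L I, injective_clm_comp (fun f g hfg => ?_) hS.embeddings.lqToW_inj,
    fun v => ?_⟩
  · have h := hI f
    rw [hfg] at h
    exact Lp.ext (h.symm.trans (hI g))
  · obtain ⟨g, hg, hgw⟩ := hS.embeddings.toW_compat v
    generalize hf : SobolevSpace.val (S.toSob v) = f at hg
    rw [ContinuousLinearMap.comp_apply, ← hgw]
    exact congrArg S.lqToW (Lp.ext ((hI f).trans hg.symm))

/-- `W^{κ,p̂}(Ω)` embeds into `W`. -/
theorem IsSetup.exists_sobolevToW (hS : S.IsSetup T p q) :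
    ∃ j : SobolevSpace κ p' Ω →L[ℝ] W, Function.Injective j ∧
      ∀ v, j (S.toSob v) = S.v'ToW (S.toV' v) := by
  obtain ⟨J, hJ, hJS⟩ := hS.exists_lpToW
  have hval := SobolevSpace.val_injective (κ := κ) (p := p') hS.isOpen
  exact ⟨J ∘L (SobolevSpace.val (Ω := Ω)), injective_clm_comp hval hJ, hJS⟩

/-- The image in `W` of a state has an integrable time derivative. -/
theorem isTimeDeriv_toW [CompleteSpace V'] [CompleteSpace W] (w : S.State T p) :
    IsTimeDeriv T (fun t => S.v'ToW (S.toV' (w.1.1 t))) (fun t => S.v'ToW (w.1.2 t)) := by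
  intro φ hφ
  have e := congrArg S.v'ToW (w.2 φ hφ)
  have i1 : Integrable (fun t => deriv φ t • (S.toV'.compLp w.1.1) t) (timeMeasure T) :=
    integrable_smul_of_test _ (hφ.1.continuous_deriv (by simp)) hφ.2.1.deriv
  have i2 : Integrable (fun t => φ t • w.1.2 t) (timeMeasure T) :=
    integrable_smul_of_test _ hφ.1.continuous hφ.2.1
  rw [map_neg, ← S.v'ToW.integral_comp_comm i1, ← S.v'ToW.integral_comp_comm i2] at e
  simp only [map_smul] at e
  rw [← e]
  refine integral_congr_ae ?_
  filter_upwards [S.toV'.coeFn_compLp w.1.1] with t ht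
  simp only [ht]

/-- Integrals over subintervals, with values in `W`, are compact operators on `𝒱`. -/
theorem IsSetup.exists_intervalIntegral_toW [CompleteSpace V] [CompleteSpace W]
    (hS : S.IsSetup T p q) {a b : ℝ} (ha : 0 ≤ a) (hab : a ≤ b) (hb : b ≤ T) :
    ∃ K : S.State T p →L[ℝ] W, IsCompactOperator K ∧
      ∀ w, K w = ∫ t in a..b, S.v'ToW (S.toV' (w.1.1 t)) := by
  obtain ⟨j, -, hjS⟩ := hS.exists_sobolevToW
  obtain ⟨I, hI⟩ := exists_setIntegral_clm (E := V) (timeMeasure T) (p := p) (Set.Ioc a b)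
  let P : S.State T p →L[ℝ] Lp V p (timeMeasure T) :=
    ContinuousLinearMap.fst ℝ _ _ ∘L (StateSpace T p S.toV').subtypeL
  -- Integrating in `V` before applying the compact embedding gives compactness. By compatibility,
  -- `j ∘ toSob` is the embedding of `V` into `W`, which commutes with the integral.
  let K : S.State T p →L[ℝ] W := j ∘L S.toSob ∘L I ∘L P
  have hK : IsCompactOperator K :=
    (hS.embeddings.toSob_compact.comp_clm (I ∘L P)).clm_comp j
  refine ⟨K, hK, fun w => ?_⟩
  have hm : (timeMeasure T).restrict (Set.Ioc a b) = volume.restrict (Set.Ioc a b) := by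
    rw [timeMeasure_eq, Measure.restrict_restrict measurableSet_Ioc,
      Set.inter_eq_left.2 (Set.Ioc_subset_Ioc ha hb)]
  have hw : Integrable (w.1.1 : ℝ → V) (timeMeasure T) :=
    memLp_one_iff_integrable.1 ((Lp.memLp w.1.1).mono_exponent Fact.out)
  have h1 : K w = j (S.toSob (I w.1.1)) := rfl
  rw [h1, hI, hjS, hm, intervalIntegral.integral_of_le hab]
  have hw' : IntegrableOn (w.1.1 : ℝ → V) (Set.Ioc a b) := by
    rw [IntegrableOn, ← hm]
    exact hw.restrict
  exact ((S.v'ToW ∘L S.toV').integral_comp_comm hw').symm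

set_option maxHeartbeats 1000000 in
/-- The Aubin–Lions lemma: weak convergence in `𝒱` implies strong convergence in
`L^1(0,T;W^{κ,p̂}(Ω))`. -/
theorem IsSetup.tendsto_integral_norm_toSob [CompleteSpace V] [CompleteSpace V']
    [CompleteSpace W] (hS : S.IsSetup T p q) {v : ℕ → S.State T p} {v' : S.State T p}
    (hv : ∀ l : StrongDual ℝ (S.State T p), Tendsto (fun m => l (v m)) atTop (𝓝 (l v'))) :
    Tendsto (fun m => ∫ t, ‖S.toSob ((v m - v').1.1 t)‖ ∂timeMeasure T) atTop (𝓝 0) := by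
  have hT := hS.time_pos
  obtain ⟨j, hj, hjS⟩ := hS.exists_sobolevToW
  have hv0 : ∀ l : StrongDual ℝ (S.State T p),
      Tendsto (fun m => l (v m - v')) atTop (𝓝 (l 0)) := fun l => by
    simpa using (hv l).sub_const (l v')
  obtain ⟨D, hD⟩ := exists_norm_le_of_tendsto_weak hv0
  obtain ⟨C₁, hC₁0, hC₁⟩ := exists_integral_norm_le (E := V) (timeMeasure T) (p := p)
  obtain ⟨C₂, hC₂0, hC₂⟩ := exists_integral_norm_le (E := V') (timeMeasure T) (p := p)
  have hD0 : 0 ≤ D := (norm_nonneg _).trans (hD 0)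
  have hint1 : ∀ w : S.State T p, Integrable (w.1.1 : ℝ → V) (timeMeasure T) := fun w =>
    memLp_one_iff_integrable.1 ((Lp.memLp w.1.1).mono_exponent Fact.out)
  have hint2 : ∀ w : S.State T p, Integrable (w.1.2 : ℝ → V') (timeMeasure T) := fun w =>
    memLp_one_iff_integrable.1 ((Lp.memLp w.1.2).mono_exponent Fact.out)
  have hRint : ∀ w : S.State T p,
      Integrable (fun t => S.v'ToW (S.toV' (w.1.1 t))) (timeMeasure T) :=
    fun w => (S.v'ToW ∘L S.toV').integrable_comp (hint1 w)
  have hgint : ∀ w : S.State T p, Integrable (fun t => S.v'ToW (w.1.2 t)) (timeMeasure T) :=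
    fun w => S.v'ToW.integrable_comp (hint2 w)
  have hn1 : ∀ m, ∫ t, ‖(v m - v').1.1 t‖ ∂timeMeasure T ≤ C₁ * D := fun m =>
    (hC₁ _).trans (mul_le_mul_of_nonneg_left ((norm_fst_le (v m - v').1).trans (hD m)) hC₁0)
  set C₃ : ℝ := ‖S.v'ToW‖ * (C₂ * D) with hC₃
  have hC₃0 : 0 ≤ C₃ := by positivity
  have hn2 : ∀ m, ∫ t, ‖S.v'ToW ((v m - v').1.2 t)‖ ∂timeMeasure T ≤ C₃ := fun m => by
    have h1 : ∫ t, ‖(v m - v').1.2 t‖ ∂timeMeasure T ≤ C₂ * D :=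
      (hC₂ _).trans (mul_le_mul_of_nonneg_left ((norm_snd_le (v m - v').1).trans (hD m)) hC₂0)
    refine le_trans ?_ (mul_le_mul_of_nonneg_left h1 (norm_nonneg S.v'ToW))
    rw [← integral_const_mul]
    exact integral_mono (hgint _).norm ((hint2 _).norm.const_mul _) fun t => S.v'ToW.le_opNorm _
  -- Strong convergence in the weaker space `L^1(0,T;W)`. `N` is chosen so that the derivative term
  -- of Poincaré's inequality is below `δ / 2` uniformly in `m`; the other `N` terms tend to zero by
  -- compactness.
  have hR : Tendsto (fun m => ∫ t, ‖S.v'ToW (S.toV' ((v m - v').1.1 t))‖ ∂timeMeasure T)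
      atTop (𝓝 0) := by
    refine Metric.tendsto_nhds.2 fun δ hδ => ?_
    obtain ⟨N, hN⟩ := exists_nat_gt (T * C₃ / (δ / 2))
    have hN0 : (0 : ℝ) < N := lt_of_le_of_lt (by positivity) hN
    have hN0' : 0 < N := Nat.cast_pos.1 hN0
    have hsmall : T / N * C₃ < δ / 2 := by
      rw [div_lt_iff₀ (half_pos hδ)] at hN
      rw [div_mul_eq_mul_div, div_lt_iff₀ hN0, mul_comm (δ / 2)]
      exact hN
    have hsum : Tendsto (fun m => ∑ i ∈ Finset.range N,
        ‖∫ t in (i * (T / N))..((i + 1 : ℕ) * (T / N)),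
          S.v'ToW (S.toV' ((v m - v').1.1 t))‖) atTop (𝓝 0) := by
      rw [← Finset.sum_const_zero (s := Finset.range N)]
      refine tendsto_finsetSum _ fun i hi => ?_
      have hiN : ((i + 1 : ℕ) : ℝ) ≤ N := Nat.cast_le.2 (Finset.mem_range.1 hi)
      have hTN : 0 ≤ T / N := (div_pos hT hN0).le
      obtain ⟨K, hK, hKw⟩ := hS.exists_intervalIntegral_toW (a := i * (T / N))
        (b := (i + 1 : ℕ) * (T / N)) (by positivity)
        (mul_le_mul_of_nonneg_right (by push_cast; linarith) hTN)
        ((mul_le_mul_of_nonneg_right hiN hTN).trans_eq (by field_simp))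
      have h := (hK.tendsto_of_tendsto_weak hv0).norm
      rw [map_zero, norm_zero] at h
      simpa only [hKw] using h
    filter_upwards [hsum.eventually (gt_mem_nhds (half_pos hδ))] with m hm
    rw [Real.dist_0_eq_abs, abs_of_nonneg (integral_nonneg fun _ => norm_nonneg _)]
    have h1 := (isTimeDeriv_toW (v m - v')).integral_norm_le_sum hT (hRint _) (hgint _) hN0'
    have h2 := mul_le_mul_of_nonneg_left (hn2 m) (div_pos hT hN0).le
    linarith
  refine Metric.tendsto_nhds.2 fun δ hδ => ?_
  -- Ehrling's inequality splits the Sobolev norm into `η` times the bounded `V` part and `C` times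
  -- the `W` part, which vanishes by `hR`. The `+ 1` covers `C₁ * D = 0`.
  obtain ⟨η, hη, hηδ⟩ : ∃ η : ℝ, 0 < η ∧ η * (C₁ * D) < δ / 2 := by
    refine ⟨δ / 2 / (C₁ * D + 1), by positivity, ?_⟩
    rw [div_mul_eq_mul_div, div_lt_iff₀ (by positivity)]
    exact mul_lt_mul_of_pos_left (by linarith) (half_pos hδ)
  obtain ⟨C, hC0, hC⟩ := hS.embeddings.toSob_compact.exists_norm_le_add hj hη
  have hCR := hR.const_mul C
  rw [mul_zero] at hCR
  filter_upwards [hCR.eventually (gt_mem_nhds (half_pos hδ))] with m hm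
  rw [Real.dist_0_eq_abs, abs_of_nonneg (integral_nonneg fun _ => norm_nonneg _)]
  calc ∫ t, ‖S.toSob ((v m - v').1.1 t)‖ ∂timeMeasure T
      ≤ ∫ t, (η * ‖(v m - v').1.1 t‖ + C * ‖S.v'ToW (S.toV' ((v m - v').1.1 t))‖)
          ∂timeMeasure T := by
        refine integral_mono (S.toSob.integrable_comp (hint1 _)).norm
          (((hint1 _).norm.const_mul _).add ((hRint _).norm.const_mul _)) fun t => ?_
        have := hC ((v m - v').1.1 t)
        rwa [hjS] at this
    _ = η * ∫ t, ‖(v m - v').1.1 t‖ ∂timeMeasure T +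
          C * ∫ t, ‖S.v'ToW (S.toV' ((v m - v').1.1 t))‖ ∂timeMeasure T := by
        rw [integral_add ((hint1 _).norm.const_mul _) ((hRint _).norm.const_mul _),
          integral_const_mul, integral_const_mul]
    _ < δ := by
        have := mul_le_mul_of_nonneg_left (hn1 m) hη.le
        linarith

end SpaceMaps

/-! ### Measurability in finite products and almost everywhere convergence -/

lemma aestronglyMeasurable_pi_of_fintype {X : Type*} [MeasurableSpace X] {μ : Measure X}
    {ι : Type*} [Fintype ι] {E : Type*} [NormedAddCommGroup E] {f : X → ι → E}
    (hf : ∀ i, AEStronglyMeasurable (fun x => f x i) μ) : AEStronglyMeasurable f μ := by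
  classical
  -- A finite sum of continuous images of the coordinates needs no separability of `E`.
  have h : f = fun x => ∑ i, Pi.single i (f x i) := funext fun x =>
    (Finset.univ_sum_single (f x)).symm
  rw [h]
  exact Finset.aestronglyMeasurable_fun_sum _ fun i _ =>
    (continuous_single i).comp_aestronglyMeasurable (hf i)

/-- Convergence in `L^1` implies convergence in measure, hence almost everywhere along a
subsequence. With `toSob` as `L`, this turns Aubin–Lions into Sobolev convergence at almost every
time. -/
theorem exists_subseq_ae_tendsto_of_integral_norm {X E F : Type*} [MeasurableSpace X]
    {μ : Measure X} [IsFiniteMeasure μ] [NormedAddCommGroup E] [NormedSpace ℝ E]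
    [NormedAddCommGroup F] [NormedSpace ℝ F] {p : ℝ≥0∞} [hp : Fact (1 ≤ p)] {L : E →L[ℝ] F}
    {f : ℕ → Lp E p μ} {g : Lp E p μ}
    (h : Tendsto (fun m => ∫ x, ‖L ((f m - g : Lp E p μ) x)‖ ∂μ) atTop (𝓝 0)) :
    ∃ ms : ℕ → ℕ, StrictMono ms ∧
      ∀ᵐ x ∂μ, Tendsto (fun m => L (f (ms m) x)) atTop (𝓝 (L (g x))) := by
  refine TendstoInMeasure.exists_seq_tendsto_ae (f := fun m x => L (f m x)) ?_
  refine tendstoInMeasure_of_tendsto_eLpNorm one_ne_zero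
    (fun m => L.continuous.comp_aestronglyMeasurable (Lp.aestronglyMeasurable _))
    (L.continuous.comp_aestronglyMeasurable (Lp.aestronglyMeasurable _)) ?_
  have h0 := ENNReal.tendsto_ofReal h
  rw [ENNReal.ofReal_zero] at h0
  refine h0.congr fun m => ?_
  have hint : Integrable (f m - g : Lp E p μ) μ :=
    memLp_one_iff_integrable.1 ((Lp.memLp _).mono_exponent hp.out)
  rw [ofReal_integral_norm_eq_lintegral_enorm (L.integrable_comp hint),
    eLpNorm_one_eq_lintegral_enorm]
  refine lintegral_congr_ae ?_
  filter_upwards [Lp.coeFn_sub (f m) g] with x hx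
  rw [hx, Pi.sub_apply, map_sub, Pi.sub_apply]

namespace SpaceMaps

variable {d κ : ℕ} {Ω : Set (EuclideanSpace ℝ (Fin d))} {p' q' : ℝ≥0∞}
  [Fact (1 ≤ p')] [Fact (1 ≤ q')] {V V' W : Type*} {Vk : Fin κ → Type*}
  [NormedAddCommGroup V] [NormedSpace ℝ V] [NormedAddCommGroup V'] [NormedSpace ℝ V']
  [NormedAddCommGroup W] [NormedSpace ℝ W]
  [∀ k, NormedAddCommGroup (Vk k)] [∀ k, NormedSpace ℝ (Vk k)]
  {S : SpaceMaps κ Ω p' q' V V' W Vk} {T : ℝ} {p q : ℝ≥0∞} [Fact (1 ≤ p)]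

theorem IsSetup.isFiniteMeasure (hS : S.IsSetup T p q) : IsFiniteMeasure (volume.restrict Ω) :=
  isFiniteMeasure_restrict.2 hS.isBounded.measure_lt_top.ne

/-! ### Inputs of the network as elements of `L^q̂(Ω)` -/

/-- The inputs of the network as functions of time with values in `L^q̂(Ω)`, where `I` is the
inclusion `L^p̂(Ω) ⊆ L^q̂(Ω)`. -/
def inputLp (S : SpaceMaps κ Ω p' q' V V' W Vk) [IsFiniteMeasure (volume.restrict Ω)]
    (I : Lp ℝ p' (volume.restrict Ω) →L[ℝ] Lp ℝ q' (volume.restrict Ω)) {τ n : ℕ}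
    (e : Fin τ ⊕ JetIdx d κ ≃ Fin n) (t : ℝ) (f : SobolevSpace κ p' Ω)
    (w : ∀ k : Fin κ, MultiIdx d (k + 1) → Vk k) (i : Fin n) : Lp ℝ q' (volume.restrict Ω) :=
  match e.symm i with
  | .inl _ => Lp.const q' _ t
  | .inr (.inl _) => I (SobolevSpace.val f)
  | .inr (.inr ⟨k, β⟩) => S.vkToLq k (w k β)

variable {I : Lp ℝ p' (volume.restrict Ω) →L[ℝ] Lp ℝ q' (volume.restrict Ω)} {τ n : ℕ}
  {e : Fin τ ⊕ JetIdx d κ ≃ Fin n}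

lemma inputLp_ae_eq [IsFiniteMeasure (volume.restrict Ω)]
    (hI : ∀ f, I f =ᵐ[volume.restrict Ω] f) (u : S.Jets T p) (t : ℝ) :
    ∀ᵐ x ∂volume.restrict Ω,
      (fun i => S.inputLp I e t (S.toSob (u.1.1.1 t)) (fun k => u.2 k t) i x) =
        S.input e u t x := by
  have h : ∀ᵐ x ∂volume.restrict Ω, ∀ i,
      S.inputLp I e t (S.toSob (u.1.1.1 t)) (fun k => u.2 k t) i x = S.input e u t x i := by
    refine ae_all_iff.2 fun i => ?_
    unfold inputLp input
    rcases e.symm i with j | j | ⟨k, β⟩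
    · filter_upwards [Lp.coeFn_const q' (volume.restrict Ω) t] with x hx using hx
    · filter_upwards [hI (SobolevSpace.val (S.toSob (u.1.1.1 t)))] with x hx using hx
    · exact Eventually.of_forall fun x => rfl
  filter_upwards [h] with x hx using funext hx

/-- Each coordinate is a continuous function of `t`, of the state or of a jet component, all of
which are strongly measurable in time. -/
lemma aestronglyMeasurable_inputLp [IsFiniteMeasure (volume.restrict Ω)]
    (u : S.Jets T p) :
    AEStronglyMeasurable
      (fun t => S.inputLp I e t (S.toSob (u.1.1.1 t)) (fun k => u.2 k t)) (timeMeasure T) := by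
  refine aestronglyMeasurable_pi_of_fintype fun i => ?_
  unfold inputLp
  rcases e.symm i with j | j | ⟨k, β⟩
  · exact (Lp.constL q' (volume.restrict Ω) ℝ : ℝ →L[ℝ] _).continuous.aestronglyMeasurable
  · exact ((I.continuous.comp SobolevSpace.val.continuous).comp
      S.toSob.continuous).comp_aestronglyMeasurable (Lp.aestronglyMeasurable u.1.1.1)
  · exact ((S.vkToLq k).continuous.comp (continuous_apply β)).comp_aestronglyMeasurable
      (Lp.aestronglyMeasurable (u.2 k))

/-- The inputs of the network that arise from the jet of a function in the Sobolev space. -/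
def sobolevInputLp (S : SpaceMaps κ Ω p' q' V V' W Vk) [IsFiniteMeasure (volume.restrict Ω)]
    (I : Lp ℝ p' (volume.restrict Ω) →L[ℝ] Lp ℝ q' (volume.restrict Ω)) {τ n : ℕ}
    (e : Fin τ ⊕ JetIdx d κ ≃ Fin n) (t : ℝ) (f : SobolevSpace κ p' Ω) :
    Fin n → Lp ℝ q' (volume.restrict Ω) :=
  S.inputLp I e t f fun k β => S.lpToVk k (SobolevSpace.deriv k β f)

lemma continuous_sobolevInputLp [IsFiniteMeasure (volume.restrict Ω)] (t : ℝ) :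
    Continuous fun f : SobolevSpace κ p' Ω => S.sobolevInputLp I e t f := by
  refine continuous_pi fun i => ?_
  unfold sobolevInputLp inputLp
  rcases e.symm i with j | j | ⟨k, β⟩
  · exact continuous_const
  · exact I.continuous.comp SobolevSpace.val.continuous
  · exact (S.vkToLq k).continuous.comp
      ((S.lpToVk k).continuous.comp (SobolevSpace.deriv k β).continuous)

lemma jetMap_ae_eq (v : S.State T p) :
    ∀ᵐ t ∂timeMeasure T, ∀ k, (S.jetMap v).2 k t =
      fun β => S.lpToVk k (SobolevSpace.deriv k β (S.toSob (v.1.1 t))) := by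
  refine ae_all_iff.2 fun k => ?_
  filter_upwards [(S.jacobian k).coeFn_compLp v.1.1] with t ht
  exact ht

/-- Jets of states are bounded, uniformly on bounded sets of states. -/
theorem IsSetup.exists_bound_jetMap (hS : S.IsSetup T p q) :
    ∃ c : ℝ, 0 < c ∧ ∀ v : S.State T p, ∀ᵐ t ∂timeMeasure T, ∀ᵐ x ∂volume.restrict Ω,
      ∀ i, |S.jetVal (S.jetMap v) t x i| ≤ c * ‖v‖ := by
  obtain ⟨c, hc, h⟩ := hS.uniform
  refine ⟨c, hc, fun v => ?_⟩
  filter_upwards [h v, jetMap_ae_eq v] with t ht hj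
  -- Jets pass through `Vk`, while the uniform bound concerns the Sobolev derivatives; compatibility
  -- identifies the two.
  have hcompat : ∀ᵐ x ∂volume.restrict Ω, ∀ (k : Fin κ) (β : MultiIdx d (k + 1)),
      S.vkToLq k ((S.jetMap v).2 k t β) x = SobolevSpace.deriv k β (S.toSob (v.1.1 t)) x := by
    refine ae_all_iff.2 fun k => ae_all_iff.2 fun β => ?_
    rw [hj k]
    exact hS.embeddings.vk_compat k _
  filter_upwards [ht, hcompat] with x hx hxc i
  rcases i with j | ⟨k, β⟩
  · exact hx.1
  · change |S.vkToLq k ((S.jetMap v).2 k t β) x| ≤ _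
    rw [hxc k β]
    exact hx.2 k β

/-! ### Nemytskii operators -/

lemma abs_input_le {M : ℝ} {t : ℝ} (ht : |t| ≤ M) {u : S.Jets T p}
    {x : EuclideanSpace ℝ (Fin d)} (h : ∀ i, |S.jetVal u t x i| ≤ M) (i : Fin n) :
    |S.input e u t x i| ≤ M := by
  unfold input
  rcases e.symm i with j | j
  · exact ht
  · exact h j

/-- On bounded inputs, truncated superposition operators agree with the network. -/
lemma superposition_ae_eq [IsFiniteMeasure (volume.restrict Ω)]
    (hI : ∀ f, I f =ᵐ[volume.restrict Ω] f) {M : ℝ} (hMT : T ≤ M)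
    {h : (Fin n → ℝ) → ℝ}
    {Φ : (Fin n → Lp ℝ q' (volume.restrict Ω)) → Lp ℝ q' (volume.restrict Ω)}
    (hΦ : ∀ y, Φ y =ᵐ[volume.restrict Ω] fun x => h (clampVec M fun i => y i x))
    {u : S.Jets T p}
    (hu : ∀ᵐ t ∂timeMeasure T, ∀ᵐ x ∂volume.restrict Ω, ∀ i, |S.jetVal u t x i| ≤ M) :
    ∀ᵐ t ∂timeMeasure T,
      Φ (S.inputLp I e t (S.toSob (u.1.1.1 t)) fun k => u.2 k t) =ᵐ[volume.restrict Ω]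
        fun x => h (S.input e u t x) := by
  filter_upwards [hu, ae_restrict_mem measurableSet_Ioo] with t ht htT
  filter_upwards [ht, hΦ _, inputLp_ae_eq (e := e) hI u t] with x hx h1 h2
  -- Time may itself be an input, so the truncation level has to be at least `T`.
  have habs : |t| ≤ M := by
    rw [abs_of_pos htT.1]
    exact htT.2.le.trans hMT
  rw [h1, h2, clampVec_of_abs_le (abs_input_le habs hx)]

/-- Essentially bounded functions induce Nemytskii operators with values in
`L^q(0,T;L^q̂(Ω))`. -/
theorem IsSetup.exists_isNemytskii [Fact (1 ≤ q)] (hS : S.IsSetup T p q) (e : Fin τ ⊕ JetIdx d κ ≃ Fin n)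
    {h : (Fin n → ℝ) → ℝ} (hh : Continuous h) {u : S.Jets T p} (hu : S.EssBounded u) :
    ∃ F : Lp (Lp ℝ q' (volume.restrict Ω)) q (timeMeasure T), S.IsNemytskii e h u F := by
  have := hS.isFiniteMeasure
  obtain ⟨I, hI⟩ := exists_inclusion_Lp (E := ℝ) (volume.restrict Ω) hS.q'_le_p'
  obtain ⟨M, hM⟩ := hu
  have hq' : q' ≠ ⊤ := ne_top_of_le_ne_top hS.p'_ne_top hS.q'_le_p'
  -- The network is fixed here, so the parameter space is a point. The level `max M T` is
  -- nonnegative and also leaves the time input unchanged.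
  obtain ⟨Φ, hΦc, hΦ, hΦb⟩ := exists_superposition (μ := volume.restrict Ω) hq'
    (H := fun z : Unit × (Fin n → ℝ) => h z.2) (hh.comp continuous_snd)
    (hS.time_pos.le.trans (le_max_right M T))
  obtain ⟨C, hC⟩ := hΦb Set.univ isCompact_univ
  have hmem : MemLp
      (fun t => Φ ((), S.inputLp I e t (S.toSob (u.1.1.1 t)) fun k => u.2 k t)) q
      (timeMeasure T) :=
    MemLp.of_bound ((hΦc.comp (Continuous.prodMk_right ())).comp_aestronglyMeasurable
      (aestronglyMeasurable_inputLp u)) C (Eventually.of_forall fun t => hC () trivial _)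
  refine ⟨hmem.toLp _, ?_⟩
  have key := superposition_ae_eq (e := e) hI (le_max_right M T) (hΦ ())
    (u := u) (hM.mono fun t ht => ht.mono fun x hx i => (hx i).trans (le_max_left M T))
  filter_upwards [hmem.coeFn_toLp, key] with t h1 h2
  rw [h1]
  exact h2

lemma IsNemytskii.unique [Fact (1 ≤ q)] {h : (Fin n → ℝ) → ℝ} {u : S.Jets T p}
    {F F' : Lp (Lp ℝ q' (volume.restrict Ω)) q (timeMeasure T)} (hF : S.IsNemytskii e h u F)
    (hF' : S.IsNemytskii e h u F') : F = F' := by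
  refine Lp.ext ?_
  filter_upwards [hF, hF'] with t h1 h2 using Lp.ext (h1.trans h2.symm)

lemma IsNemytskiiW.unique [Fact (1 ≤ q)] {h : (Fin n → ℝ) → ℝ} {u : S.Jets T p}
    {G G' : Lp W q (timeMeasure T)} (hG : S.IsNemytskiiW e h u G)
    (hG' : S.IsNemytskiiW e h u G') : G = G' := by
  refine Lp.ext ?_
  filter_upwards [hG, hG'] with t ⟨f, h1, h2⟩ ⟨f', h1', h2'⟩
  rw [h2, h2', Lp.ext (h1.trans h1'.symm)]

lemma IsNemytskii.toW [Fact (1 ≤ q)] {h : (Fin n → ℝ) → ℝ} {u : S.Jets T p}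
    {F : Lp (Lp ℝ q' (volume.restrict Ω)) q (timeMeasure T)} (hF : S.IsNemytskii e h u F) :
    S.IsNemytskiiW e h u (S.lqToW.compLpL q (timeMeasure T) F) := by
  filter_upwards [hF, S.lqToW.coeFn_compLpL F] with t h1 h2 using ⟨F t, h1, h2⟩

lemma inputLp_jetMap_ae_eq [IsFiniteMeasure (volume.restrict Ω)] (v : S.State T p) :
    ∀ᵐ t ∂timeMeasure T, S.inputLp I e t (S.toSob ((S.jetMap v).1.1.1 t))
      (fun k => (S.jetMap v).2 k t) = S.sobolevInputLp I e t (S.toSob (v.1.1 t)) := by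
  filter_upwards [jetMap_ae_eq v] with t ht
  exact congrArg (S.inputLp I e t (S.toSob (v.1.1 t))) (funext ht)

/-- On jets of bounded states, Nemytskii operators are truncated superposition operators. -/
lemma IsNemytskii.ae_eq_superposition [Fact (1 ≤ q)] [IsFiniteMeasure (volume.restrict Ω)]
    (hI : ∀ f, I f =ᵐ[volume.restrict Ω] f) {M : ℝ} (hMT : T ≤ M) {h : (Fin n → ℝ) → ℝ}
    {Φ : (Fin n → Lp ℝ q' (volume.restrict Ω)) → Lp ℝ q' (volume.restrict Ω)}
    (hΦ : ∀ y, Φ y =ᵐ[volume.restrict Ω] fun x => h (clampVec M fun i => y i x))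
    {v : S.State T p}
    (hv : ∀ᵐ t ∂timeMeasure T, ∀ᵐ x ∂volume.restrict Ω,
      ∀ i, |S.jetVal (S.jetMap v) t x i| ≤ M)
    {F : Lp (Lp ℝ q' (volume.restrict Ω)) q (timeMeasure T)}
    (hF : S.IsNemytskii e h (S.jetMap v) F) :
    ∀ᵐ t ∂timeMeasure T, F t = Φ (S.sobolevInputLp I e t (S.toSob (v.1.1 t))) := by
  filter_upwards [hF, superposition_ae_eq (e := e) hI hMT hΦ hv, inputLp_jetMap_ae_eq v]
    with t h1 h2 h3
  rw [h3] at h2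
  exact Lp.ext (h1.trans h2.symm)

set_option maxHeartbeats 1000000 in
/-- Weak-strong continuity of parametrised Nemytskii operators on jets of states. -/
theorem IsSetup.tendsto_nemytskii [CompleteSpace V] [CompleteSpace V'] [CompleteSpace W]
    [Fact (1 ≤ q)] (hS : S.IsSetup T p q) {Θ : Type*} [TopologicalSpace Θ] [FirstCountableTopology Θ]
    {H : Θ × (Fin n → ℝ) → ℝ} (hH : Continuous H) {θ : ℕ → Θ} {θ' : Θ}
    (hθ : Tendsto θ atTop (𝓝 θ')) {v : ℕ → S.State T p} {v' : S.State T p}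
    (hv : ∀ l : StrongDual ℝ (S.State T p), Tendsto (fun m => l (v m)) atTop (𝓝 (l v')))
    {F : ℕ → Lp (Lp ℝ q' (volume.restrict Ω)) q (timeMeasure T)}
    {F' : Lp (Lp ℝ q' (volume.restrict Ω)) q (timeMeasure T)}
    (hF : ∀ m, S.IsNemytskii e (fun x => H (θ m, x)) (S.jetMap (v m)) (F m))
    (hF' : S.IsNemytskii e (fun x => H (θ', x)) (S.jetMap v') F') :
    Tendsto F atTop (𝓝 F') := by
  have := hS.isFiniteMeasure
  obtain ⟨I, hI⟩ := exists_inclusion_Lp (E := ℝ) (volume.restrict Ω) hS.q'_le_p'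
  have hq' : q' ≠ ⊤ := ne_top_of_le_ne_top hS.p'_ne_top hS.q'_le_p'
  have hq : q ≠ ⊤ := ne_top_of_le_ne_top hS.p_ne_top hS.q_le_p
  obtain ⟨c, hc, hcv⟩ := hS.exists_bound_jetMap
  obtain ⟨D, hD⟩ := exists_norm_le_of_tendsto_weak hv
  -- One truncation level for the whole sequence, its limit and the time variable, so that a single
  -- operator `Φ` represents all terms.
  set M : ℝ := max (max (c * D) (c * ‖v'‖)) T with hM
  obtain ⟨Φ, hΦc, hΦ, hΦb⟩ := exists_superposition (μ := volume.restrict Ω) (r := q') hq' hH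
    (hS.time_pos.le.trans (le_max_right _ T) : 0 ≤ M)
  obtain ⟨C, hC⟩ := hΦb _ hθ.isCompact_insert_range
  have hrepr : ∀ (θ : Θ) (v : S.State T p), c * ‖v‖ ≤ M →
      ∀ F : Lp (Lp ℝ q' (volume.restrict Ω)) q (timeMeasure T),
        S.IsNemytskii e (fun x => H (θ, x)) (S.jetMap v) F → ∀ᵐ t ∂timeMeasure T,
          F t = Φ (θ, S.sobolevInputLp I e t (S.toSob (v.1.1 t))) := fun θ v hvM F hF =>
    IsNemytskii.ae_eq_superposition (v := v) (h := fun x => H (θ, x))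
      (Φ := fun y => Φ (θ, y)) hI (le_max_right _ T : T ≤ M) (hΦ θ)
      ((hcv v).mono fun t ht => ht.mono fun x hx i => (hx i).trans hvM) hF
  have hFm := ae_all_iff.2 fun m => hrepr (θ m) (v m)
    ((mul_le_mul_of_nonneg_left (hD m) hc.le).trans
      ((le_max_left _ _).trans (le_max_left _ T))) (F m) (hF m)
  have hFl := hrepr θ' v' ((le_max_right _ _).trans (le_max_left _ T)) F' hF'
  refine tendsto_of_subseq_tendsto fun ns hns => ?_
  obtain ⟨ms, hms, hae⟩ := exists_subseq_ae_tendsto_of_integral_norm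
    ((hS.tendsto_integral_norm_toSob hv).comp hns)
  refine ⟨ms, tendsto_Lp_of_ae_bound hq C (fun m => ?_) ?_⟩
  · filter_upwards [hFm] with t ht
    rw [ht (ns (ms m))]
    exact hC _ (Or.inr ⟨_, rfl⟩) _
  · filter_upwards [hFm, hFl, hae] with t h1 h2 h3
    simp only [h1, h2]
    -- At such a time `t`, parameters and Sobolev-valued inputs converge together, and joint
    -- continuity of `Φ` applies.
    exact (hΦc.tendsto _).comp ((hθ.comp (hns.comp hms.tendsto_atTop)).prodMk_nhds
      (((continuous_sobolevInputLp t).tendsto _).comp h3))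

end SpaceMaps

end

/-! ### Assembly of the proposition -/

theorem proposition2p6 {d κ : ℕ} {Ω : Set (EuclideanSpace ℝ (Fin d))} {T : ℝ}
    {p q p' q' : ℝ≥0∞} [Fact (1 ≤ p)] [Fact (1 ≤ q)] [Fact (1 ≤ p')] [Fact (1 ≤ q')]
    {V V' W : Type*} {Vk : Fin κ → Type*}
    [NormedAddCommGroup V] [NormedSpace ℝ V] [CompleteSpace V]
    [NormedAddCommGroup V'] [NormedSpace ℝ V'] [CompleteSpace V']
    [NormedAddCommGroup W] [NormedSpace ℝ W] [CompleteSpace W]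
    [∀ k, NormedAddCommGroup (Vk k)] [∀ k, NormedSpace ℝ (Vk k)] [∀ k, CompleteSpace (Vk k)]
    (S : SpaceMaps κ Ω p' q' V V' W Vk) (hS : S.IsSetup T p q)
    (A : SymArch) (hσ : ∀ i, 1 ≤ i → i ≤ A.L → Continuous (A.σ i))
    (ε : ℝ) (hε : 0 < ε) :
    -- networks whose inputs are `(t, u(t,x))` (`τ = 1`) or `u(t,x)` (`τ = 0`)
    (∀ (τ : ℕ) (_ : τ ≤ 1) (e : Fin τ ⊕ JetIdx d κ ≃ Fin (A.nσ 0)),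
      (∀ v : S.State T p, S.EssBounded (S.jetMap v)) ∧
      (∀ θ ∈ A.paramSet ε, ∀ u : S.Jets T p, S.EssBounded u →
        (∃! F : Lp (Lp ℝ q' (volume.restrict Ω)) q (timeMeasure T),
          S.IsNemytskii e (A.net θ) u F) ∧
        (∃! G : Lp W q (timeMeasure T), S.IsNemytskiiW e (A.net θ) u G)) ∧
      ((∀ i, 1 ≤ i → i ≤ A.L → LocallyLipschitz (A.σ i)) →
        ∃ N : A.paramSet ε × S.State T p → Lp W q (timeMeasure T),
          (∀ θ v, S.IsNemytskiiW e (A.net θ.1) (S.jetMap v) (N (θ, v))) ∧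
          ∀ (θ : ℕ → A.paramSet ε) (θ' : A.paramSet ε) (v : ℕ → S.State T p) (v' : S.State T p),
            Tendsto θ atTop (𝓝 θ') →
            (∀ l : StrongDual ℝ (S.State T p), Tendsto (fun m => l (v m)) atTop (𝓝 (l v'))) →
            Tendsto (fun m => N (θ m, v m)) atTop (𝓝 (N (θ', v'))))) ∧
    (∀ U : Set (Fin (A.nσ 0) → ℝ), Bornology.IsBounded U →
      ∃ Φ : A.paramSet ε → Lp ℝ ∞ (volume.restrict U),
        (∀ θ, Φ θ =ᵐ[volume.restrict U] A.net θ.1) ∧ Continuous Φ) := by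
  refine ⟨fun τ hτ e => ⟨fun v => ?_, fun θ hθ u hu => ?_, fun _ => ?_⟩, fun U hU => ?_⟩
  · obtain ⟨c, -, hc⟩ := hS.exists_bound_jetMap
    exact ⟨c * ‖v‖, hc v⟩
  · have hh : Continuous (A.net θ) :=
      (SymArch.continuous_net hσ hε).comp (Continuous.prodMk_right (⟨θ, hθ⟩ : A.paramSet ε))
    obtain ⟨F, hF⟩ := hS.exists_isNemytskii e hh hu
    exact ⟨⟨F, hF, fun F' hF' => hF'.unique hF⟩, _, hF.toW, fun G hG => hG.unique hF.toW⟩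
  · have hex : ∀ z : A.paramSet ε × S.State T p,
        ∃ F : Lp (Lp ℝ q' (volume.restrict Ω)) q (timeMeasure T),
          S.IsNemytskii e (A.net z.1.1) (S.jetMap z.2) F := fun z => by
      obtain ⟨c, -, hc⟩ := hS.exists_bound_jetMap
      exact hS.exists_isNemytskii e
        ((SymArch.continuous_net hσ hε).comp (Continuous.prodMk_right z.1)) ⟨_, hc z.2⟩
    choose F hF using hex
    -- Convergence is proved in `L^q(0,T;L^q̂(Ω))` and transported to `W` by the embedding acting
    -- pointwise in time.
    refine ⟨fun z => S.lqToW.compLpL q (timeMeasure T) (F z), fun θ v => (hF (θ, v)).toW,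
      fun θ θ' v v' hθ hv => ?_⟩
    exact ((S.lqToW.compLpL q (timeMeasure T)).continuous.tendsto _).comp
      (hS.tendsto_nemytskii (SymArch.continuous_net hσ hε) hθ hv (fun m => hF (θ m, v m))
        (hF (θ', v')))
  · exact exists_continuous_toLinfty volume (SymArch.continuous_net hσ hε) hU
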